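/- Fix $R>0$ and $0<\lambda_{\min}<\lambda_{\max}$. For $d\in\mathbb N$ let $\mathbb S_d^+(\lambda_{\min},\lambda_{\max})$ be the set of symmetric positive-definite $d\times d$ real matrices with all eigenvalues in $[\lambda_{\min},\lambda_{\max}]$, and let $$f(x\mid\theta,\Sigma)=\frac{\exp\left(-\tfrac12(x-\theta)^\top\Sigma^{-1}(x-\theta)\right)}{(2\pi)^{d/2}|\Sigma|^{1/2}},\qquad x,\theta\in\mathbb R^d,$$ be the Gaussian kernel, with characteristic function $\Phi_\Sigma(\xi)=\int_{\mathbb R^d}e^{i\xi^\top x}f(x\mid 0,\Sigma)\,dx$. For a measurable set $\mathcal X\subseteq\{x\in\mathbb R^d:\|x\|\le R\}$ let $\mathscr G=\mathscr G(\mathcal X)$ be the set of all $G=P\times\delta_\Sigma$ with $P$ a Borel probability measure on $\mathbb R^d$, $\mathrm{supp}(P)\subseteq\mathcal X$ and $\Sigma\in\mathbb S_d^+(\lambda_{\min},\lambda_{\max})$. Put $p_G(x)=\int f(x\mid\theta,\Sigma)\,P(d\theta)$ and $\|p-q\|_1=\int_{\mathbb R^d}|p(x)-q(x)|\,dx$.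 Let $W_1$ be the Wasserstein distance of order $1$ for the Euclidean metric and $\|\cdot\|_{\mathrm{op}}$ the operator norm. For $M>0$ put $$\Psi_M(t)=\exp\left(-M\,\frac{\log(1/t)}{t}\right)\ (t>0),\qquad \Psi_M(0)=0 .$$ **Theorem.** (a) The Gaussian kernel is super-smooth of order $2$: for every $d$ there are constants $c_1,c_2>0$, depending only on $\lambda_{\min},\lambda_{\max},d$, such that $\exp(-c_1\|\xi\|^2)\le|\Phi_\Sigma(\xi)|\le\exp(-c_2\|\xi\|^2)$ for all $\xi\in\mathbb R^d$ and $\Sigma\in\mathbb S_d^+(\lambda_{\min},\lambda_{\max})$. (b) There is a constant $M>0$, depending only on $R,\lambda_{\min},\lambda_{\max}$ (not on $d$), such that $\Psi_M$ is strictly increasing on $[0,e]$ and the following hold for every $d$, with constants $C_1,C_1^*,C_2,C,C',\tilde C>0$ depending only on $R,\lambda_{\min},\lambda_{\max},d$ (in particular not on $\mathcal X$). 1. (Assumption 1) For every measurable $\mathcal X\subseteq\{\|x\|\le R\}$ and all $G=P\times\delta_\Sigma$, $G'=P'\times\delta_{\Sigma'}$ in $\mathscr G$, $$\|p_G-p_{G'}\|_1\ge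 C_1\,\Psi_M(\|\Sigma-\Sigma'\|_{\mathrm{op}}).$$ Moreover, there is a strictly increasing function $\Psi:[0,\infty)\to[0,\infty)$ with $\Psi=\Psi_M$ on $[0,e]$ such that $\|p_G-p_{G'}\|_1\ge C_1^*\,\Psi(\|\Sigma-\Sigma'\|_{\mathrm{op}})$ for all such $\mathcal X$, $G$, $G'$. 2. (Assumption 2 with $\Xi(t)=t$ and $p=2$) For all $\xi\in\mathbb R^d$ and $\Sigma,\Sigma'\in\mathbb S_d^+(\lambda_{\min},\lambda_{\max})$, $$|\Phi_{\Sigma'}(\xi)-\Phi_\Sigma(\xi)|\le C_2\,\|\Sigma-\Sigma'\|_{\mathrm{op}}\,\|\xi\|^2\max\{|\Phi_{\Sigma'}(\xi)|,|\Phi_\Sigma(\xi)|\}.$$ 3. For every measurable $\mathcal X\subseteq\{\|x\|\le R\}$ and all $G=P\times\delta_\Sigma$, $G'=P'\times\delta_{\Sigma'}$ in $\mathscr G$, $$\|p_G-p_{G'}\|_1\ge C'\left[\exp\left(-\frac{C\exp\big(\tilde C/W_1(P,P')^2\big)}{W_1(P,P')^2}\right)+\exp\left(-M\,\frac{\log(1/\|\Sigma-\Sigma'\|_{\mathrm{op}})}{\|\Sigma-\Sigma'\|_{\mathrm{op}}}\right)\right],$$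 where the first exponential is read as $0$ if $W_1(P,P')=0$ and the second as $0$ if $\Sigma=\Sigma'$. -/

import Mathlib

open MeasureTheory Set

open scoped ENNReal Matrix

noncomputable section

namespace LocScale

/-- Euclidean space of dimension `d`. -/
abbrev E (d : ℕ) : Type := EuclideanSpace ℝ (Fin d)

/-- A location-scale family of functions: `f x θ S` stands for `f(x | θ, S)`. -/
abbrev Kern (d : ℕ) : Type := E d → E d → Matrix (Fin d) (Fin d) ℝ → ℝ

/-- The multivariate Gaussian density with mean `θ` and covariance matrix `S`. -/
def gaussianKern (d : ℕ) : Kern d := fun x θ S =>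
  Real.exp (-(1 / 2) * ((x - θ).ofLp ⬝ᵥ (S⁻¹ *ᵥ (x - θ).ofLp))) /
    ((2 * Real.pi) ^ ((d : ℝ) / 2) * Real.sqrt S.det)

/-- Symmetric positive definite matrices with all eigenvalues in `[lmin, lmax]`. -/
def spdBand (d : ℕ) (lmin lmax : ℝ) : Set (Matrix (Fin d) (Fin d) ℝ) :=
  {S | S.PosDef ∧ ∀ μ ∈ spectrum ℝ S, lmin ≤ μ ∧ μ ≤ lmax}

/-- Operator norm of a matrix acting on Euclidean space. -/
def opNorm {d : ℕ} (A : Matrix (Fin d) (Fin d) ℝ) : ℝ :=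
  ‖Matrix.toEuclideanCLM (n := Fin d) (𝕜 := ℝ) A‖

/-- The mixing measures `P × δ_S` with `P` a probability measure supported in `X` and `S` in the
band of scale matrices. Such a product is encoded by the pair `(P, S)`. -/
def mixingClass (d : ℕ) (X : Set (E d)) (lmin lmax : ℝ) :
    Set (Measure (E d) × Matrix (Fin d) (Fin d) ℝ) :=
  {G | IsProbabilityMeasure G.1 ∧ G.1.support ⊆ X ∧ G.2 ∈ spdBand d lmin lmax}

/-- The mixture density `x ↦ ∫ f(x | θ, S) P(dθ)`. -/
def mixtureDensity {d : ℕ} (f : Kern d) (G : Measure (E d) × Matrix (Fin d) (Fin d) ℝ)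
    (x : E d) : ℝ :=
  ∫ θ, f x θ G.2 ∂G.1

/-- The `L¹` distance of two functions with respect to Lebesgue measure. -/
def l1Dist {d : ℕ} (p q : E d → ℝ) : ℝ := ∫ x, |p x - q x|

/-- The Wasserstein distance of order one: infimum over all couplings of the transport cost
for the Euclidean metric. -/
def W1 {d : ℕ} (P Q : Measure (E d)) : ℝ :=
  (⨅ π ∈ {π : Measure (E d × E d) | π.map Prod.fst = P ∧ π.map Prod.snd = Q},
    ∫⁻ z, edist z.1 z.2 ∂π).toReal

/-- The characteristic function of the density `f(· | 0, S)`. -/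
def kernCharFun {d : ℕ} (f : Kern d) (S : Matrix (Fin d) (Fin d) ℝ) (ξ : E d) : ℂ :=
  ∫ x, Complex.exp (Complex.I * ((inner ℝ ξ x : ℝ) : ℂ)) * ((f x 0 S : ℝ) : ℂ)

/-- Super-smoothness of order `α`. -/
def IsSuperSmooth {d : ℕ} (f : Kern d) (lmin lmax α : ℝ) : Prop :=
  0 < α ∧ ∃ c₁ > 0, ∃ c₂ > 0, ∀ S ∈ spdBand d lmin lmax, ∀ ξ : E d,
    Real.exp (-c₁ * ‖ξ‖ ^ α) ≤ ‖kernCharFun f S ξ‖ ∧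
      ‖kernCharFun f S ξ‖ ≤ Real.exp (-c₂ * ‖ξ‖ ^ α)

/-- The `L¹` distance of two mixtures dominates `Ψ` of the distance of their scale matrices, with
a constant that is uniform over all measurable location sets in the ball of radius `R`. -/
def ScaleLowerBound {d : ℕ} (f : Kern d) (R lmin lmax : ℝ) (Ψ : ℝ → ℝ) : Prop :=
  ∃ C > 0, ∀ X : Set (E d), MeasurableSet X → X ⊆ Metric.closedBall 0 R →
    ∀ G ∈ mixingClass d X lmin lmax, ∀ G' ∈ mixingClass d X lmin lmax,
      C * Ψ (opNorm (G.2 - G'.2)) ≤ l1Dist (mixtureDensity f G) (mixtureDensity f G')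

/-- The first assumption: the scale lower bound holds with `Ψ : [0, ∞) → [0, ∞)` strictly
increasing. -/
def Assumption1 {d : ℕ} (f : Kern d) (R lmin lmax : ℝ) (Ψ : ℝ → ℝ) : Prop :=
  StrictMonoOn Ψ (Ici 0) ∧ MapsTo Ψ (Ici 0) (Ici 0) ∧ ScaleLowerBound f R lmin lmax Ψ

/-- The second assumption, with exponent `p ≥ 1` and `Ξ : [0, ∞) → [0, ∞)` strictly increasing:
controlled variation of the characteristic function in the scale matrix. -/
def Assumption2 {d : ℕ} (f : Kern d) (lmin lmax : ℝ) (p : ℝ) (Ξ : ℝ → ℝ) : Prop :=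
  1 ≤ p ∧ StrictMonoOn Ξ (Ici 0) ∧ MapsTo Ξ (Ici 0) (Ici 0) ∧
    ∃ C > 0, ∀ S ∈ spdBand d lmin lmax, ∀ S' ∈ spdBand d lmin lmax, ∀ ξ : E d,
      ‖kernCharFun f S' ξ - kernCharFun f S ξ‖ ≤
        C * Ξ (opNorm (S - S')) * ‖ξ‖ ^ p *
          max ‖kernCharFun f S' ξ‖ ‖kernCharFun f S ξ‖

/-- `t ↦ exp (-M log(1/t) / t)`, extended to `t = 0` by its limit `0`. -/
def gaussianPsi (M t : ℝ) : ℝ :=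
  if t = 0 then 0 else Real.exp (-(M * (Real.log (1 / t) / t)))

/-- `w ↦ exp (-C exp(Ct / w²) / w²)`, extended to `w = 0` by its limit `0`. -/
def gaussianPhi (C Ct w : ℝ) : ℝ :=
  if w = 0 then 0 else Real.exp (-(C * Real.exp (Ct / w ^ 2) / w ^ 2))

end LocScale

end

/-! Let ε be the `L¹` distance of the mixtures, t the operator norm of the difference of the scale
matrices and w the Wasserstein distance of the mixing measures. A Gaussian mixture is a convolution,
so its Fourier transform is the characteristic function of P times exp(-`quad S ξ` / 2), and ε
bounds the difference of two such products at every frequency (`norm_charFun_sub_le`).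
Super-smoothness and Assumption 2 are read off the same exponential.

Scale. Project onto a unit vector v where the quadratic form of S - S' is at least t/2 in absolute
value, and divide out the Gaussian of smaller variance. A measure μ on [-R, R] then faces ν ∗ N(0,
τ), with ν also on [-R, R] and τ ≥ t/2; their characteristic functions differ at r by at most ε
exp(lmax r² / 2). The test function (2 - 2 cos(ηx))^k is at most (4k)^(-k) on [-R, R] and at least
k^(-k) on an interval outside it, to which the Gaussian tail gives mass of order exp(-18R²/τ) up to
a prefactor. Some k of order 1/t makes the second integral win, whence ε ≥ (16k)^(-k) exp(-O(k)),
which is `exists_exp_le_l1Dist`. Everything happens on a line, so M does not depend on d.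

Location. Products of Bernstein polynomials in (1 + sin(x_i/R))/2 form a partition of unity
consisting of trigonometric polynomials, each concentrated on the ball. Coupling P and P' piece by
piece bounds w by a concentration error plus 2^(nd) times the discrepancy of the characteristic
functions at frequencies up to dn/R (`W1_le_of_charFun_sub_le`). That discrepancy is at most ε
exp(lmax r²/2) + t r²/2 with r = dn/R (`norm_charFun_sub_charFun_le`). With n of order 1/w², either
ε is at least exp(-O(1/w² + 1/w⁴)), or t ≥ exp(-a/w²); in the latter case the scale bound at this t
produces the double exponential (`exists_gaussianPhi_le`). -/

namespace LocScale

/-! ### Quadratic forms and operator norms of scale matrices -/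

/-- The quadratic form of a matrix on Euclidean space. -/
def quad {d : ℕ} (S : Matrix (Fin d) (Fin d) ℝ) (v : E d) : ℝ := v.ofLp ⬝ᵥ (S *ᵥ v.ofLp)

variable {d : ℕ}

lemma quad_eq_inner (S : Matrix (Fin d) (Fin d) ℝ) (v : E d) :
    quad S v = inner ℝ v (Matrix.toEuclideanCLM (n := Fin d) (𝕜 := ℝ) S v) :=
  (Matrix.inner_toEuclideanCLM S v v).symm

lemma quad_sub (S S' : Matrix (Fin d) (Fin d) ℝ) (v : E d) :
    quad (S - S') v = quad S v - quad S' v := by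
  simp [quad, Matrix.sub_mulVec]

lemma quad_one (v : E d) : quad 1 v = ‖v‖ ^ 2 := by
  rw [quad_eq_inner]; simp

lemma quad_smul_matrix (c : ℝ) (S : Matrix (Fin d) (Fin d) ℝ) (v : E d) :
    quad (c • S) v = c * quad S v := by
  simp [quad, Matrix.smul_mulVec]

lemma quad_smul (S : Matrix (Fin d) (Fin d) ℝ) (r : ℝ) (v : E d) :
    quad S (r • v) = r ^ 2 * quad S v := by
  simp [quad, Matrix.mulVec_smul]; ring

lemma quad_nonneg {S : Matrix (Fin d) (Fin d) ℝ} (hS : S.PosSemidef) (v : E d) : 0 ≤ quad S v := by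
  simpa [quad] using hS.dotProduct_mulVec_nonneg v.ofLp

section band

variable {lmin lmax : ℝ} {S : Matrix (Fin d) (Fin d) ℝ}

/-- Subtracting `lmin • 1` shifts the spectrum into [0, ∞), and a Hermitian matrix with such a
spectrum is positive semidefinite. -/
lemma le_quad (hS : S ∈ spdBand d lmin lmax) (v : E d) : lmin * ‖v‖ ^ 2 ≤ quad S v := by
  have h : (S - lmin • (1 : Matrix (Fin d) (Fin d) ℝ)).PosSemidef := by
    rw [Matrix.posSemidef_iff_isHermitian_and_spectrum_nonneg]
    refine ⟨hS.1.1.sub (Matrix.isHermitian_one.smul (by simp [IsSelfAdjoint])), fun a ha => ?_⟩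
    have : a + lmin ∈ spectrum ℝ S := by
      rw [← Algebra.algebraMap_eq_smul_one, ← spectrum.sub_singleton_eq] at ha
      obtain ⟨b, hb, rfl⟩ := by simpa using ha
      simpa using hb
    have := (hS.2 _ this).1
    simp only [mem_ofPred_eq]; linarith
  have := quad_nonneg h v
  rw [quad_sub, quad_smul_matrix, quad_one] at this
  linarith

lemma quad_le (hS : S ∈ spdBand d lmin lmax) (v : E d) : quad S v ≤ lmax * ‖v‖ ^ 2 := by
  have h : (lmax • (1 : Matrix (Fin d) (Fin d) ℝ) - S).PosSemidef := by
    rw [Matrix.posSemidef_iff_isHermitian_and_spectrum_nonneg]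
    refine ⟨(Matrix.isHermitian_one.smul (by simp [IsSelfAdjoint])).sub hS.1.1, fun a ha => ?_⟩
    have : lmax - a ∈ spectrum ℝ S := by
      rw [← Algebra.algebraMap_eq_smul_one, ← spectrum.singleton_sub_eq] at ha
      obtain ⟨b, hb, rfl⟩ := by simpa using ha
      simpa using hb
    have := (hS.2 _ this).2
    simp only [mem_ofPred_eq]; linarith
  have := quad_nonneg h v
  rw [quad_sub, quad_smul_matrix, quad_one] at this
  linarith

end band

lemma abs_quad_le_opNorm (D : Matrix (Fin d) (Fin d) ℝ) (v : E d) :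
    |quad D v| ≤ opNorm D * ‖v‖ ^ 2 := by
  rw [quad_eq_inner]
  calc _ ≤ ‖v‖ * ‖Matrix.toEuclideanCLM (n := Fin d) (𝕜 := ℝ) D v‖ := abs_real_inner_le_norm _ _
    _ ≤ ‖v‖ * (opNorm D * ‖v‖) := by
      gcongr; exact ContinuousLinearMap.le_opNorm _ _
    _ = _ := by ring

/-- Polarization: a bound on the quadratic form of a symmetric matrix bounds its operator norm. -/
lemma opNorm_le_of_quad_le {D : Matrix (Fin d) (Fin d) ℝ} (hD : D.IsHermitian) {s : ℝ}
    (hs : 0 ≤ s) (h : ∀ v, |quad D v| ≤ s * ‖v‖ ^ 2) : opNorm D ≤ s := by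
  have hsymm : ∀ x y : E d, y.ofLp ⬝ᵥ (D *ᵥ x.ofLp) = x.ofLp ⬝ᵥ (D *ᵥ y.ofLp) := by
    intro x y
    have hT : Dᵀ = D := by simpa using hD.eq
    rw [Matrix.dotProduct_mulVec, ← Matrix.mulVec_transpose, hT, dotProduct_comm]
  have key : ∀ x y : E d, ‖x‖ = 1 → ‖y‖ = 1 →
      inner ℝ y (Matrix.toEuclideanCLM (n := Fin d) (𝕜 := ℝ) D x) ≤ s := by
    intro x y hx hy
    have e : 4 * inner ℝ y (Matrix.toEuclideanCLM (n := Fin d) (𝕜 := ℝ) D x)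
        = quad D (x + y) - quad D (x - y) := by
      rw [Matrix.inner_toEuclideanCLM]
      simp only [quad, WithLp.ofLp_add, WithLp.ofLp_sub, Matrix.mulVec_add, Matrix.mulVec_sub,
        add_dotProduct, dotProduct_add, sub_dotProduct, dotProduct_sub]
      rw [hsymm x y]; ring
    have p := parallelogram_law_with_norm ℝ x y
    rw [hx, hy] at p
    have h1 := (abs_le.1 (h (x + y))).2
    have h2 := (abs_le.1 (h (x - y))).1
    nlinarith
  refine ContinuousLinearMap.opNorm_le_of_unit_norm hs fun x hx => ?_
  set z := Matrix.toEuclideanCLM (n := Fin d) (𝕜 := ℝ) D x with hz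
  by_cases h0 : z = 0
  · simpa [h0] using hs
  have hn : 0 < ‖z‖ := norm_pos_iff.2 h0
  have := key x (‖z‖⁻¹ • z) hx (by rw [norm_smul]; simp [hn.ne'])
  rw [← hz, real_inner_smul_left, real_inner_self_eq_norm_sq] at this
  calc ‖z‖ = ‖z‖⁻¹ * ‖z‖ ^ 2 := by field_simp
    _ ≤ s := this

lemma opNorm_nonneg (D : Matrix (Fin d) (Fin d) ℝ) : 0 ≤ opNorm D := norm_nonneg _

lemma opNorm_sub_comm (S S' : Matrix (Fin d) (Fin d) ℝ) : opNorm (S - S') = opNorm (S' - S) := by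
  rw [opNorm, opNorm, ← neg_sub, map_neg, norm_neg]

lemma opNorm_sub_le {lmin lmax : ℝ} {S S' : Matrix (Fin d) (Fin d) ℝ} (h0 : 0 < lmin)
    (h1 : lmin < lmax) (hS : S ∈ spdBand d lmin lmax) (hS' : S' ∈ spdBand d lmin lmax) :
    opNorm (S - S') ≤ lmax := by
  refine opNorm_le_of_quad_le (hS.1.1.sub hS'.1.1) (h0.trans h1).le fun v => ?_
  have := le_quad hS v
  have := le_quad hS' v
  have := quad_le hS v
  have := quad_le hS' v
  have : 0 ≤ lmin * ‖v‖ ^ 2 := by positivity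
  rw [quad_sub, abs_le]; constructor <;> linarith

/-- A symmetric matrix of positive operator norm has a unit vector on which its quadratic form is at
least half the norm. -/
lemma exists_unit_le_abs_quad {D : Matrix (Fin d) (Fin d) ℝ} (hD : D.IsHermitian)
    (h : 0 < opNorm D) : ∃ v : E d, ‖v‖ = 1 ∧ opNorm D / 2 ≤ |quad D v| := by
  -- Settling for half the norm avoids showing that the supremum is attained: otherwise polarization
  -- would give `opNorm D ≤ opNorm D / 2`.
  by_contra! hc
  have : opNorm D ≤ opNorm D / 2 := by
    refine opNorm_le_of_quad_le hD (by positivity) fun v => ?_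
    rcases eq_or_ne v 0 with rfl | hv
    · simp [quad]
    have hn : 0 < ‖v‖ := norm_pos_iff.2 hv
    have := hc (‖v‖⁻¹ • v) (by rw [norm_smul]; simp [hn.ne'])
    rw [quad_smul, abs_mul, abs_of_nonneg (by positivity), inv_pow,
      inv_mul_lt_iff₀ (by positivity)] at this
    linarith
  linarith

/-! ### Fourier transforms of Gaussians and of their mixtures -/

open scoped MatrixOrder in
/-- The characteristic function of the centred Gaussian density. -/
lemma kernCharFun_gaussianKern {S : Matrix (Fin d) (Fin d) ℝ} (hS : S.PosDef) (ξ : E d) :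
    kernCharFun (gaussianKern d) S ξ = ((Real.exp (-(quad S ξ / 2)) : ℝ) : ℂ) := by
  -- The substitution x = T y with T the square root of S reduces to the standard Gaussian: `quad
  -- S⁻¹` becomes ‖y‖², and the Jacobian cancels the normalization.
  set T := CFC.sqrt S with hTdef
  have hTT : T * T = S := CFC.sqrt_mul_sqrt_self S hS.posSemidef.nonneg
  have hTsymm : Tᵀ = T := by
    have h : (CFC.sqrt S).PosSemidef := Matrix.nonneg_iff_posSemidef.1 (CFC.sqrt_nonneg S)
    simpa using h.1.eq
  have hdetT : T.det = Real.sqrt S.det := by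
    have := hS.posSemidef.det_sqrt
    simpa [RCLike.sqrt_of_nonneg hS.posSemidef.det_nonneg] using this
  have hdpos : 0 < Real.sqrt S.det := Real.sqrt_pos.2 hS.det_pos
  set L : E d →ₗ[ℝ] E d := Matrix.toEuclideanLin T with hL
  have hdetL : LinearMap.det L = T.det := by
    have := LinearMap.det_toLin (PiLp.basisFun 2 ℝ (Fin d)) T
    rwa [← Matrix.toLpLin_eq_toLin 2 2] at this
  have hLne : LinearMap.det L ≠ 0 := by rw [hdetL, hdetT]; exact hdpos.ne'
  have hmap := Measure.map_linearMap_addHaar_eq_smul_addHaar (volume : Measure (E d)) hLne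
  have hquadinv : ∀ y : E d, quad S⁻¹ (L y) = ‖y‖ ^ 2 := by
    intro y
    have hu : IsUnit T.det := by rw [hdetT]; exact hdpos.ne'.isUnit
    have : T * (S⁻¹ * T) = 1 := by
      rw [← hTT, Matrix.mul_inv_rev, mul_assoc, Matrix.nonsing_inv_mul _ hu, mul_one,
        Matrix.mul_nonsing_inv _ hu]
    rw [← quad_one, ← this]
    simp only [quad, hL, Matrix.toLpLin_apply]
    rw [← Matrix.mulVec_mulVec, ← Matrix.mulVec_mulVec, Matrix.dotProduct_mulVec (v := y.ofLp),
      ← Matrix.mulVec_transpose, hTsymm]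
  have hinner : ∀ y : E d, inner ℝ ξ (L y) = inner ℝ (L ξ) y := by
    intro y
    simp only [hL, EuclideanSpace.inner_eq_star_dotProduct,
      Matrix.toLpLin_apply]
    simp only [star_trivial]
    rw [dotProduct_comm, Matrix.dotProduct_mulVec,  ← Matrix.mulVec_transpose, hTsymm,
      dotProduct_comm]
  have hnorm : ‖L ξ‖ ^ 2 = quad S ξ := by
    rw [← real_inner_self_eq_norm_sq]
    simp only [hL, EuclideanSpace.inner_eq_star_dotProduct,
      Matrix.toLpLin_apply, quad, star_trivial]
    rw [← hTT, ← Matrix.mulVec_mulVec, Matrix.dotProduct_mulVec ξ.ofLp,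
      ← Matrix.mulVec_transpose, hTsymm]
  have hLmeas : Measurable L := (LinearMap.continuous_of_finiteDimensional L).measurable
  have hLcont : Continuous L := LinearMap.continuous_of_finiteDimensional L
  set c : ℝ := (2 * Real.pi) ^ ((d : ℝ) / 2) with hc
  have hcpos : 0 < c := by positivity
  set F : E d → ℂ := fun x =>
    Complex.exp (Complex.I * ((inner ℝ ξ x : ℝ) : ℂ)) * ((gaussianKern d x 0 S : ℝ) : ℂ) with hF
  have hFcont : Continuous F := by
    simp only [hF, gaussianKern]
    fun_prop
  have h1 : ∫ y, F (L y) = |T.det|⁻¹ • ∫ x, F x := by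
    rw [← integral_map hLcont.measurable.aemeasurable hFcont.aestronglyMeasurable, hmap,
      integral_smul_measure, hdetL, ENNReal.toReal_ofReal (abs_nonneg _), abs_inv]
  have h2 : ∀ y, F (L y) = ((1 / (c * Real.sqrt S.det) : ℝ) : ℂ) *
      Complex.exp (-(1 / 2 : ℂ) * ‖y‖ ^ 2 + Complex.I * ((inner ℝ (L ξ) y : ℝ) : ℂ)) := by
    intro y
    have hq : (L y - 0).ofLp ⬝ᵥ (S⁻¹ *ᵥ (L y - 0).ofLp) = ‖y‖ ^ 2 := by
      rw [sub_zero]; exact hquadinv y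
    simp only [hF, gaussianKern]
    rw [hq, hinner, Complex.exp_add]
    push_cast
    ring
  have h3 : ∫ y, F (L y) = ((1 / (c * Real.sqrt S.det) * (c * Real.exp (-(quad S ξ / 2))) : ℝ) : ℂ)
      := by
    simp_rw [h2]
    rw [integral_const_mul, GaussianFourier.integral_cexp_neg_mul_sq_norm_add (by norm_num)]
    have e1 : ((Real.pi : ℂ) / (1 / 2)) ^ ((Module.finrank ℝ (E d) : ℂ) / 2) = (c : ℂ) := by
      rw [hc, Complex.ofReal_cpow (by positivity)]
      simp [mul_comm]
    have e2 : Complex.I ^ 2 * (‖L ξ‖ : ℂ) ^ 2 / (4 * (1 / 2)) = ((-(quad S ξ / 2) : ℝ) : ℂ) := by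
      rw [← hnorm]; push_cast; rw [Complex.I_sq]; ring
    rw [e1, e2]
    push_cast
    ring
  have h4 : kernCharFun (gaussianKern d) S ξ = ∫ x, F x := rfl
  rw [h4]
  have h5 : |T.det|⁻¹ • ∫ x, F x = (((Real.sqrt S.det)⁻¹ : ℝ) : ℂ) * ∫ x, F x := by
    rw [hdetT, abs_of_pos hdpos]; simp
  rw [h3, h5] at h1
  have h6 : (((Real.sqrt S.det)⁻¹ : ℝ) : ℂ) ≠ 0 := by
    exact_mod_cast (inv_pos.2 hdpos).ne'
  refine mul_left_cancel₀ h6 ?_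
  rw [← h1, ← Complex.ofReal_mul]
  congr 1
  field_simp

lemma gaussianKern_nonneg (S : Matrix (Fin d) (Fin d) ℝ) (x θ : E d) :
    0 ≤ gaussianKern d x θ S := by
  unfold gaussianKern; positivity

lemma gaussianKern_sub (S : Matrix (Fin d) (Fin d) ℝ) (x θ : E d) :
    gaussianKern d x θ S = gaussianKern d (x - θ) 0 S := by
  simp [gaussianKern]

lemma continuous_gaussianKern (S : Matrix (Fin d) (Fin d) ℝ) :
    Continuous fun z : E d × E d => gaussianKern d z.1 z.2 S := by
  unfold gaussianKern; fun_prop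

lemma integrable_gaussianKern {S : Matrix (Fin d) (Fin d) ℝ} (hS : S.PosDef) :
    Integrable fun x => gaussianKern d x 0 S := by
  have h := kernCharFun_gaussianKern hS 0
  -- Without integrability the Bochner integral takes its default value 0, while the formula at ξ =
  -- 0 gives a positive number.
  by_contra hc
  have : kernCharFun (gaussianKern d) S 0 = 0 := by
    unfold kernCharFun
    refine integral_undef fun hi => hc ?_
    refine hi.norm.congr (.of_forall fun x => ?_)
    simp [abs_of_nonneg (gaussianKern_nonneg S x 0)]
  rw [this] at h
  exact (Real.exp_pos _).ne (by exact_mod_cast h)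

section mixture

variable {S S' : Matrix (Fin d) (Fin d) ℝ} {P P' : Measure (E d)}

lemma integrable_prod_gaussianKern [IsProbabilityMeasure P] (hS : S.PosDef) :
    Integrable (fun z : E d × E d => gaussianKern d z.1 z.2 S) (volume.prod P) := by
  have hm := (continuous_gaussianKern S).aestronglyMeasurable (μ := (volume : Measure (E d)).prod P)
  rw [integrable_prod_iff' hm]
  have e : ∀ θ, ∫ x, ‖gaussianKern d x θ S‖ = ∫ x, ‖gaussianKern d x 0 S‖ := by
    intro θ
    simp_rw [gaussianKern_sub S _ θ]
    exact integral_sub_right_eq_self (fun x => ‖gaussianKern d x 0 S‖) θ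
  refine ⟨.of_forall fun θ => ?_, ?_⟩
  · simp_rw [gaussianKern_sub S _ θ]
    exact (integrable_gaussianKern hS).comp_sub_right θ
  · simp_rw [e]; exact integrable_const _

lemma integrable_mixtureDensity [IsProbabilityMeasure P] (hS : S.PosDef) :
    Integrable (mixtureDensity (gaussianKern d) (P, S)) :=
  (integrable_prod_gaussianKern hS).integral_prod_left

/-- Fubini and a translation by θ: the mixture is the convolution of P with the centred Gaussian. -/
lemma integral_mixtureDensity [IsProbabilityMeasure P] (hS : S.PosDef) (ξ : E d) :
    ∫ x, Complex.exp (Complex.I * ((inner ℝ ξ x : ℝ) : ℂ)) *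
      ((mixtureDensity (gaussianKern d) (P, S) x : ℝ) : ℂ) =
    charFun P ξ * ((Real.exp (-(quad S ξ / 2)) : ℝ) : ℂ) := by
  have hint : Integrable (fun z : E d × E d => Complex.exp (Complex.I * ((inner ℝ ξ z.1 : ℝ) : ℂ)) *
      ((gaussianKern d z.1 z.2 S : ℝ) : ℂ)) (volume.prod P) := by
    refine (integrable_prod_gaussianKern (P := P) hS).mono' ?_ (.of_forall fun z => ?_)
    · have := continuous_gaussianKern S
      exact Continuous.aestronglyMeasurable (by fun_prop)
    · rw [norm_mul, mul_comm Complex.I, Complex.norm_exp_ofReal_mul_I, one_mul, Complex.norm_real,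
        Real.norm_of_nonneg (gaussianKern_nonneg _ _ _)]
  calc _ = ∫ x, ∫ θ, Complex.exp (Complex.I * ((inner ℝ ξ x : ℝ) : ℂ)) *
        ((gaussianKern d x θ S : ℝ) : ℂ) ∂P := by
        congr 1; ext x
        rw [integral_const_mul, integral_complex_ofReal]; rfl
    _ = ∫ θ, (∫ x, Complex.exp (Complex.I * ((inner ℝ ξ x : ℝ) : ℂ)) *
        ((gaussianKern d x θ S : ℝ) : ℂ)) ∂P := integral_integral_swap hint
    _ = ∫ θ, Complex.exp ((inner ℝ θ ξ : ℝ) * Complex.I) *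
          ((Real.exp (-(quad S ξ / 2)) : ℝ) : ℂ) ∂P := by
        congr 1; ext θ
        rw [← kernCharFun_gaussianKern hS, kernCharFun, ← integral_const_mul,
          ← integral_add_right_eq_self (μ := volume) _ θ]
        congr 1; ext x
        rw [gaussianKern_sub S (x + θ) θ, add_sub_cancel_right, ← mul_assoc, ← Complex.exp_add,
          real_inner_comm ξ θ, inner_add_right]
        congr 2; push_cast; ring
    _ = _ := by rw [integral_mul_const, charFun_apply]

/-- The `L¹` distance of two Gaussian mixtures dominates the distance of their characteristic
functions. -/
lemma norm_charFun_sub_le [IsProbabilityMeasure P] [IsProbabilityMeasure P'] (hS : S.PosDef)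
    (hS' : S'.PosDef) (ξ : E d) :
    ‖charFun P ξ * ((Real.exp (-(quad S ξ / 2)) : ℝ) : ℂ) -
      charFun P' ξ * ((Real.exp (-(quad S' ξ / 2)) : ℝ) : ℂ)‖ ≤
    l1Dist (mixtureDensity (gaussianKern d) (P, S)) (mixtureDensity (gaussianKern d) (P', S')) := by
  have hi : ∀ {p : E d → ℝ}, Integrable p →
      Integrable fun x => Complex.exp (Complex.I * ((inner ℝ ξ x : ℝ) : ℂ)) * ((p x : ℝ) : ℂ) := by
    intro p hp
    refine hp.ofReal.bdd_mul (c := 1) (Continuous.aestronglyMeasurable (by fun_prop))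
      (.of_forall fun x => ?_)
    rw [mul_comm Complex.I, Complex.norm_exp_ofReal_mul_I]
  rw [← integral_mixtureDensity hS, ← integral_mixtureDensity hS',
    ← integral_sub (hi (integrable_mixtureDensity hS)) (hi (integrable_mixtureDensity hS'))]
  refine (norm_integral_le_integral_norm _).trans (le_of_eq ?_)
  unfold l1Dist
  congr 1; ext x
  rw [← mul_sub, norm_mul, mul_comm Complex.I, Complex.norm_exp_ofReal_mul_I, one_mul,
    ← Complex.ofReal_sub, Complex.norm_real, Real.norm_eq_abs]

end mixture

lemma l1Dist_nonneg (p q : E d → ℝ) : 0 ≤ l1Dist p q := integral_nonneg fun _ => abs_nonneg _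

lemma l1Dist_comm (p q : E d → ℝ) : l1Dist p q = l1Dist q p := by
  simp_rw [l1Dist, abs_sub_comm]

/-! ### Super-smoothness and Assumption 2 -/

lemma isSuperSmooth_gaussianKern {lmin lmax : ℝ} (hmin : 0 < lmin) (hlt : lmin < lmax) :
    IsSuperSmooth (gaussianKern d) lmin lmax 2 := by
  refine ⟨two_pos, lmax / 2, by linarith, lmin / 2, by linarith, fun S hS ξ => ?_⟩
  rw [kernCharFun_gaussianKern hS.1, Complex.norm_real, Real.norm_of_nonneg (Real.exp_pos _).le,
    Real.rpow_two, Real.exp_le_exp, Real.exp_le_exp]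
  have := le_quad hS ξ
  have := quad_le hS ξ
  constructor <;> linarith

lemma abs_exp_neg_sub_exp_neg_le (a b : ℝ) :
    |Real.exp (-a) - Real.exp (-b)| ≤ |a - b| * max (Real.exp (-a)) (Real.exp (-b)) := by
  wlog h : a ≤ b generalizing a b
  · rw [abs_sub_comm, abs_sub_comm a, max_comm]; exact this b a (le_of_not_ge h)
  have h1 : Real.exp (-b) ≤ Real.exp (-a) := Real.exp_le_exp.2 (by linarith)
  rw [max_eq_left h1, abs_of_nonneg (by linarith), abs_sub_comm, abs_of_nonneg (by linarith)]
  have h2 : Real.exp (-b) = Real.exp (-a) * Real.exp (-(b - a)) := by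
    rw [← Real.exp_add]; congr 1; ring
  have h3 := Real.add_one_le_exp (-(b - a))
  nlinarith [Real.exp_pos (-a)]

lemma assumption2_gaussianKern {lmin lmax : ℝ} :
    Assumption2 (gaussianKern d) lmin lmax 2 (fun t => t) := by
  refine ⟨one_le_two, strictMonoOn_id, fun x hx => hx, 1 / 2, by norm_num,
    fun S hS S' hS' ξ => ?_⟩
  rw [kernCharFun_gaussianKern hS.1, kernCharFun_gaussianKern hS'.1, ← Complex.ofReal_sub]
  simp only [Complex.norm_real, Real.norm_eq_abs, Real.abs_exp, Real.rpow_two]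
  refine (abs_exp_neg_sub_exp_neg_le _ _).trans ?_
  gcongr
  have := abs_quad_le_opNorm (S - S') ξ
  rw [quad_sub, abs_sub_comm] at this
  rw [← sub_div, abs_div, abs_two]
  linarith


/-! ### Trigonometric polynomials as test functions -/

section trig

variable {V : Type*} [NormedAddCommGroup V] [InnerProductSpace ℝ V]

/-- `f` is a trigonometric polynomial with frequencies of norm at most `r`, whose coefficients have
absolute values summing up to at most `K`. -/
def IsTrigPoly (f : V → ℂ) (K r : ℝ) : Prop :=
  ∃ (ι : Type) (s : Finset ι) (c : ι → ℂ) (w : ι → V), (∀ i ∈ s, ‖w i‖ ≤ r) ∧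
    ∑ i ∈ s, ‖c i‖ ≤ K ∧ ∀ x, f x = ∑ i ∈ s, c i * Complex.exp ((inner ℝ x (w i) : ℝ) * Complex.I)

namespace IsTrigPoly

variable {f g : V → ℂ} {K K' r r' : ℝ}

lemma mono (hf : IsTrigPoly f K r) (hK : K ≤ K') (hr : r ≤ r') : IsTrigPoly f K' r' := by
  obtain ⟨ι, s, c, w, h1, h2, h3⟩ := hf
  exact ⟨ι, s, c, w, fun i hi => (h1 i hi).trans hr, h2.trans hK, h3⟩

lemma exp (c : ℂ) (w : V) :
    IsTrigPoly (fun x => c * Complex.exp ((inner ℝ x w : ℝ) * Complex.I)) ‖c‖ ‖w‖ :=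
  ⟨Unit, {()}, fun _ => c, fun _ => w, by simp, by simp, by simp⟩

lemma const (c : ℂ) : IsTrigPoly (fun _ : V => c) ‖c‖ 0 := by
  simpa using exp c (0 : V)

lemma add (hf : IsTrigPoly f K r) (hg : IsTrigPoly g K' r') :
    IsTrigPoly (fun x => f x + g x) (K + K') (max r r') := by
  obtain ⟨ι, s, c, w, h1, h2, h3⟩ := hf
  obtain ⟨ι', s', c', w', h1', h2', h3'⟩ := hg
  refine ⟨ι ⊕ ι', s.disjSum s', Sum.elim c c', Sum.elim w w', ?_, ?_, fun x => ?_⟩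
  · rintro (i | i) hi
    · exact (h1 i (by simpa using hi)).trans (le_max_left _ _)
    · exact (h1' i (by simpa using hi)).trans (le_max_right _ _)
  · rw [Finset.sum_disjSum]; exact add_le_add h2 h2'
  · simp only [Finset.sum_disjSum, h3, h3', Sum.elim_inl, Sum.elim_inr]

lemma mul (hf : IsTrigPoly f K r) (hg : IsTrigPoly g K' r') :
    IsTrigPoly (fun x => f x * g x) (K * K') (r + r') := by
  obtain ⟨ι, s, c, w, h1, h2, h3⟩ := hf
  obtain ⟨ι', s', c', w', h1', h2', h3'⟩ := hg
  refine ⟨ι × ι', s ×ˢ s', fun i => c i.1 * c' i.2, fun i => w i.1 + w' i.2, ?_, ?_, fun x => ?_⟩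
  · intro i hi
    rw [Finset.mem_product] at hi
    exact (norm_add_le _ _).trans (add_le_add (h1 _ hi.1) (h1' _ hi.2))
  · simp_rw [norm_mul]
    rw [Finset.sum_product, ← Finset.sum_mul_sum s s' (fun i => ‖c i‖) (fun i => ‖c' i‖)]
    exact mul_le_mul h2 h2' (Finset.sum_nonneg fun _ _ => norm_nonneg _)
      ((Finset.sum_nonneg fun _ _ => norm_nonneg _).trans h2)
  · simp only [h3, h3']
    rw [Finset.sum_mul_sum, Finset.sum_product]
    refine Finset.sum_congr rfl fun i _ => Finset.sum_congr rfl fun j _ => ?_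
    rw [inner_add_right, Complex.ofReal_add, add_mul, Complex.exp_add]
    ring

lemma pow (hf : IsTrigPoly f K r) (n : ℕ) : IsTrigPoly (fun x => f x ^ n) (K ^ n) (n * r) := by
  induction n with
  | zero => simpa using const (V := V) 1
  | succ n ih =>
    simp_rw [pow_succ]
    convert ih.mul hf using 1
    push_cast; ring

lemma prod {ι : Type*} (s : Finset ι) {F : ι → V → ℂ} {C : ι → ℝ}
    (hF : ∀ i ∈ s, IsTrigPoly (F i) (C i) r) :
    IsTrigPoly (fun x => ∏ i ∈ s, F i x) (∏ i ∈ s, C i) (s.card * r) := by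
  classical
  induction s using Finset.induction_on with
  | empty => simpa using const (V := V) 1
  | insert i s hi ih =>
    simp_rw [Finset.prod_insert hi]
    convert (hF i (by simp)).mul (ih fun j hj => hF j (by simp [hj])) using 1
    rw [Finset.card_insert_of_notMem hi]; push_cast; ring

/-- Trigonometric polynomials test the difference of two measures through their characteristic
functions. -/
lemma norm_integral_sub_le [MeasurableSpace V] [BorelSpace V] [SecondCountableTopology V]
    (hf : IsTrigPoly f K r) {μ ν : Measure V} [IsFiniteMeasure μ] [IsFiniteMeasure ν] {δ : ℝ}
    (hδ : 0 ≤ δ) (h : ∀ w, ‖w‖ ≤ r → ‖charFun μ w - charFun ν w‖ ≤ δ) :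
    ‖∫ x, f x ∂μ - ∫ x, f x ∂ν‖ ≤ K * δ := by
  obtain ⟨ι, s, c, w, h1, h2, h3⟩ := hf
  have key : ∀ (ρ : Measure V) [IsFiniteMeasure ρ], ∫ x, f x ∂ρ = ∑ i ∈ s, c i * charFun ρ (w i) := by
    intro ρ _
    simp_rw [h3]
    rw [integral_finsetSum]
    · simp_rw [integral_const_mul, charFun_apply]
    · intro i _
      refine Integrable.const_mul ?_ _
      refine (integrable_const (1 : ℝ)).mono' (Continuous.aestronglyMeasurable (by fun_prop))
        (.of_forall fun x => ?_)
      rw [Complex.norm_exp_ofReal_mul_I]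
  rw [key, key, ← Finset.sum_sub_distrib]
  calc _ ≤ ∑ i ∈ s, ‖c i‖ * δ := by
        refine norm_sum_le_of_le _ fun i hi => ?_
        rw [← mul_sub, norm_mul]
        gcongr
        exact h _ (h1 i hi)
    _ ≤ K * δ := by rw [← Finset.sum_mul]; gcongr

end IsTrigPoly

lemma isTrigPoly_two_sub_two_cos (h : ℝ) (hh : 0 ≤ h) :
    IsTrigPoly (fun x : ℝ => ((2 - 2 * Real.cos (h * x) : ℝ) : ℂ)) 4 h := by
  have := ((IsTrigPoly.const (V := ℝ) 2).add (IsTrigPoly.exp (V := ℝ) (-1) h)).add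
    (IsTrigPoly.exp (V := ℝ) (-1) (-h))
  convert this.mono (K' := 4) (r' := h) (by norm_num) (by simp [abs_of_nonneg hh, hh]) using 2 with x
  have e := Complex.two_cos (h * x)
  simp only [RCLike.inner_apply, conj_trivial]
  push_cast
  rw [e, show ((-h : ℂ) * x) * Complex.I = -(h * x) * Complex.I by ring]
  ring

lemma isTrigPoly_sin (w : V) :
    IsTrigPoly (fun x => ((Real.sin (inner ℝ x w) : ℝ) : ℂ)) 1 ‖w‖ := by
  have := (IsTrigPoly.exp (-Complex.I / 2) w).add (IsTrigPoly.exp (Complex.I / 2) (-w))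
  convert this.mono (K' := 1) (r' := ‖w‖) (by simp; norm_num) (by simp) using 2 with x
  rw [Complex.ofReal_sin, Complex.sin, inner_neg_right]
  push_cast
  ring

end trig

/-! ### Separating a measure on an interval from a Gaussian convolution -/

section scale

open ProbabilityTheory

lemma integrable_of_abs_le {α : Type*} [MeasurableSpace α] {μ : Measure α} [IsFiniteMeasure μ]
    {g : α → ℝ} (hg : AEStronglyMeasurable g μ) {c : ℝ} (h : ∀ x, |g x| ≤ c) : Integrable g μ :=
  (integrable_const c).mono' hg (.of_forall h)

lemma two_sub_two_cos_eq (u : ℝ) : 2 - 2 * Real.cos u = 4 * Real.sin (u / 2) ^ 2 := by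
  have h := Real.cos_two_mul (u / 2)
  rw [mul_div_cancel₀ u two_ne_zero] at h
  rw [Real.sin_sq, h]; ring

/-- The mass that a Gaussian convolution of a measure on `[-R, R]` puts far from `[-R, R]`. -/
lemma le_conv_gaussianReal_Icc {R τ : ℝ} (hR : 0 < R) (hτ : 0 < τ) {ν : Measure ℝ}
    [IsProbabilityMeasure ν] (hν : ∀ᵐ x ∂ν, |x| ≤ R) :
    R / Real.sqrt (2 * Real.pi * τ) * Real.exp (-(18 * R ^ 2 / τ)) ≤
      (ν ∗ gaussianReal 0 τ.toNNReal).real (Icc (Real.pi * R) ((Real.pi + 1) * R)) := by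
  set p := R / Real.sqrt (2 * Real.pi * τ) * Real.exp (-(18 * R ^ 2 / τ)) with hp
  set J := Icc (Real.pi * R) ((Real.pi + 1) * R) with hJ
  have hτ' : τ.toNNReal ≠ 0 := by simpa using hτ
  have hpt : ∀ x, |x| ≤ R → ENNReal.ofReal p ≤ gaussianReal 0 τ.toNNReal ((x + ·) ⁻¹' J) := by
    intro x hx
    have hpre : (x + ·) ⁻¹' J = Icc (Real.pi * R - x) ((Real.pi + 1) * R - x) := by
      ext y; simp only [hJ, mem_preimage, mem_Icc]
      constructor <;> rintro ⟨h1, h2⟩ <;> constructor <;> linarith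
    rw [hpre, gaussianReal_apply _ hτ']
    have hx' := abs_le.1 hx
    have hlow : ∀ y ∈ Icc (Real.pi * R - x) ((Real.pi + 1) * R - x),
        ENNReal.ofReal ((Real.sqrt (2 * Real.pi * τ))⁻¹ * Real.exp (-(18 * R ^ 2 / τ))) ≤
          gaussianPDF 0 τ.toNNReal y := by
      intro y hy
      rw [gaussianPDF, gaussianPDFReal, Real.coe_toNNReal _ hτ.le]
      refine ENNReal.ofReal_le_ofReal ?_
      gcongr
      rw [sub_zero, neg_div, neg_le_neg_iff, div_le_div_iff₀ (by positivity) hτ]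
      -- Since π < 4, a point of the shifted interval satisfies |y| ≤ 6R, so y²/(2τ) ≤ 18R²/τ.
      have hpi := Real.pi_lt_four
      have hpi' := Real.pi_pos
      have h1 : -(6 * R) ≤ y := by nlinarith [hy.1]
      have h2 : y ≤ 6 * R := by nlinarith [hy.2]
      nlinarith [mul_nonneg (by linarith : 0 ≤ 6 * R - y) (by linarith : 0 ≤ 6 * R + y)]
    calc ENNReal.ofReal p = ENNReal.ofReal ((Real.sqrt (2 * Real.pi * τ))⁻¹ *
            Real.exp (-(18 * R ^ 2 / τ))) *
            volume (Icc (Real.pi * R - x) ((Real.pi + 1) * R - x)) := by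
          rw [Real.volume_Icc, ← ENNReal.ofReal_mul (by positivity), hp]
          congr 1; field_simp; ring
      _ ≤ _ := by
          rw [← setLIntegral_const]
          exact setLIntegral_mono' measurableSet_Icc hlow
  have hmass : ENNReal.ofReal p ≤ (ν ∗ gaussianReal 0 τ.toNNReal) J := by
    rw [Measure.conv, Measure.map_apply (by fun_prop) measurableSet_Icc,
      Measure.prod_apply (measurableSet_Icc.preimage (by fun_prop))]
    calc ENNReal.ofReal p = ∫⁻ _, ENNReal.ofReal p ∂ν := by simp
      _ ≤ _ := lintegral_mono_ae (by
        filter_upwards [hν] with x hx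
        exact hpt x hx)
  exact (ENNReal.ofReal_le_iff_le_toReal (measure_ne_top _ _)).1 hmass

lemma charFun_conv_gaussianReal {τ : ℝ} (hτ : 0 < τ) (ν : Measure ℝ) [IsProbabilityMeasure ν]
    (r : ℝ) : charFun (ν ∗ gaussianReal 0 τ.toNNReal) r =
      charFun ν r * ((Real.exp (-(τ * r ^ 2 / 2)) : ℝ) : ℂ) := by
  rw [charFun_conv, charFun_gaussianReal]
  simp [Real.coe_toNNReal _ hτ.le]

/-- A measure on `[-R, R]` and a Gaussian convolution of another one are separated by a power of
`2 - 2 cos`. -/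
lemma le_of_charFun_sub_le {R τ lam ε : ℝ} (hR : 0 < R) (hτ : 0 < τ) (hlam : 0 ≤ lam) (hε : 0 ≤ ε)
    {μ ν : Measure ℝ} [IsProbabilityMeasure μ] [IsProbabilityMeasure ν]
    (hμ : ∀ᵐ x ∂μ, |x| ≤ R) (hν : ∀ᵐ x ∂ν, |x| ≤ R)
    (h : ∀ r : ℝ, ‖charFun μ r - charFun ν r * ((Real.exp (-(τ * r ^ 2 / 2)) : ℝ) : ℂ)‖ ≤
      ε * Real.exp (lam * r ^ 2 / 2))
    {k : ℕ} (hk : 1 ≤ k)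
    (hkp : 2 * (1 / 4) ^ k ≤ R / Real.sqrt (2 * Real.pi * τ) * Real.exp (-(18 * R ^ 2 / τ))) :
    (1 / (16 * k)) ^ k * Real.exp (-(lam * k / (8 * R ^ 2))) ≤ ε := by
  set p := R / Real.sqrt (2 * Real.pi * τ) * Real.exp (-(18 * R ^ 2 / τ)) with hp
  set ρ := ν ∗ gaussianReal 0 τ.toNNReal with hρ
  set J := Icc (Real.pi * R) ((Real.pi + 1) * R) with hJ
  have hk0 : (0 : ℝ) < k := by exact_mod_cast hk
  have hk1 : (1 : ℝ) ≤ Real.sqrt k := Real.one_le_sqrt.2 (by exact_mod_cast hk)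
  -- The top frequency kη is √k/(2R), so the deconvolution factor costs exp(lam k/(8R²)), linear in
  -- k; a fixed η would cost a multiple of k² in the exponent.
  set η : ℝ := 1 / (2 * R * Real.sqrt k) with hη
  have hη0 : 0 < η := by positivity
  have hηsq : η ^ 2 = 1 / (4 * R ^ 2 * k) := by
    rw [hη, div_pow, mul_pow, mul_pow, Real.sq_sqrt hk0.le]; norm_num
  set g : ℝ → ℝ := fun x => (2 - 2 * Real.cos (η * x)) ^ k with hg
  have hgc : Continuous g := by fun_prop
  have hbase : ∀ x, 0 ≤ 2 - 2 * Real.cos (η * x) := fun x => by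
    linarith [Real.cos_le_one (η * x)]
  have hg0 : ∀ x, 0 ≤ g x := fun x => pow_nonneg (hbase x) k
  have hg4 : ∀ x, |g x| ≤ 4 ^ k := fun x => by
    rw [abs_of_nonneg (hg0 x)]
    exact pow_le_pow_left₀ (hbase x) (by linarith [Real.neg_one_le_cos (η * x)]) k
  have hgi : ∀ (m : Measure ℝ) [IsFiniteMeasure m], Integrable g m := fun m _ =>
    integrable_of_abs_le hgc.aestronglyMeasurable hg4
  have hup : ∫ x, g x ∂μ ≤ (1 / (4 * k)) ^ k := by
    calc ∫ x, g x ∂μ ≤ ∫ _, (1 / (4 * (k : ℝ))) ^ k ∂μ := by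
          refine integral_mono_ae (hgi μ) (integrable_const _) ?_
          filter_upwards [hμ] with x hx
          refine pow_le_pow_left₀ (hbase x) ?_ k
          have h1 := Real.one_sub_sq_div_two_le_cos (x := η * x)
          have h2 : (η * x) ^ 2 ≤ 1 / (4 * k) := by
            have : x ^ 2 ≤ R ^ 2 := sq_le_sq' (abs_le.1 hx).1 (abs_le.1 hx).2
            calc (η * x) ^ 2 = η ^ 2 * x ^ 2 := by ring
              _ ≤ η ^ 2 * R ^ 2 := by gcongr
              _ = 1 / (4 * k) := by rw [hηsq]; field_simp
          linarith
      _ = _ := by simp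
  have hlowJ : ∀ y ∈ J, (1 / (k : ℝ)) ^ k ≤ g y := by
    intro y hy
    refine pow_le_pow_left₀ (by positivity) ?_ k
    rw [two_sub_two_cos_eq]
    have hpi := Real.pi_gt_three
    have hy0 : 0 ≤ y := le_trans (by positivity) hy.1
    have hle : η * y / 2 ≤ Real.pi / 2 := by
      have : η * y ≤ 1 / (2 * R) * ((Real.pi + 1) * R) := by
        refine mul_le_mul ?_ hy.2 hy0 (by positivity)
        rw [hη]
        exact one_div_le_one_div_of_le (by positivity) (by nlinarith)
      have h3 : 1 / (2 * R) * ((Real.pi + 1) * R) = (Real.pi + 1) / 2 := by field_simp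
      linarith
    -- Jordan's inequality loses a factor π/2 against sin u ≈ u; starting the interval at πR
    -- restores sin(ηy/2) ≥ ηR, so the base is at least 4(ηR)² = 1/k.
    have hs := Real.mul_le_sin (x := η * y / 2) (by positivity) hle
    have h4 : η * R ≤ 2 / Real.pi * (η * y / 2) := by
      calc η * R = 1 / Real.pi * (η * (Real.pi * R)) := by field_simp
        _ ≤ 1 / Real.pi * (η * y) := by gcongr; exact hy.1
        _ = _ := by ring
    calc 1 / (k : ℝ) = 4 * (η * R) ^ 2 := by rw [mul_pow, hηsq]; field_simp
      _ ≤ 4 * Real.sin (η * y / 2) ^ 2 := by gcongr; linarith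
  have hlow : (1 / (k : ℝ)) ^ k * p ≤ ∫ x, g x ∂ρ := by
    calc (1 / (k : ℝ)) ^ k * p ≤ (1 / (k : ℝ)) ^ k * ρ.real J := by
          gcongr
          exact le_conv_gaussianReal_Icc hR hτ hν
      _ = ∫ x, J.indicator (fun _ => (1 / (k : ℝ)) ^ k) x ∂ρ := by
          rw [integral_indicator measurableSet_Icc, setIntegral_const, smul_eq_mul, mul_comm]
      _ ≤ _ := by
          refine integral_mono ((integrable_const _).indicator measurableSet_Icc) (hgi ρ) fun x => ?_
          by_cases hx : x ∈ J
          · simpa [hx] using hlowJ x hx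
          · simpa [hx] using hg0 x
  have htrig : IsTrigPoly (fun x : ℝ => ((g x : ℝ) : ℂ)) (4 ^ k) (k * η) := by
    simpa [hg] using (isTrigPoly_two_sub_two_cos η hη0.le).pow k
  have hdiff := htrig.norm_integral_sub_le (μ := ρ) (ν := μ)
    (δ := ε * Real.exp (lam * k / (8 * R ^ 2))) (by positivity) (fun w hw => by
      rw [hρ, charFun_conv_gaussianReal hτ, norm_sub_rev]
      refine (h w).trans (mul_le_mul_of_nonneg_left (Real.exp_le_exp.2 ?_) hε)
      rw [div_le_div_iff₀ (by positivity) (by positivity)]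
      have : w ^ 2 ≤ (k * η) ^ 2 := sq_le_sq' (abs_le.1 hw).1 (abs_le.1 hw).2
      rw [mul_pow, hηsq] at this
      calc lam * w ^ 2 * (8 * R ^ 2) ≤ lam * ((k : ℝ) ^ 2 * (1 / (4 * R ^ 2 * k))) * (8 * R ^ 2) := by
            gcongr
        _ = lam * k * 2 := by field_simp; ring)
  rw [integral_complex_ofReal, integral_complex_ofReal, ← Complex.ofReal_sub, Complex.norm_real,
    Real.norm_eq_abs] at hdiff
  have hfin := (le_abs_self _).trans hdiff
  have e4 : (1 / (4 * (k : ℝ))) ^ k = (1 / (k : ℝ)) ^ k * (1 / 4) ^ k := by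
    rw [← mul_pow]; congr 1; field_simp
  -- By `hkp` the integral against ρ is at least twice the upper bound for the integral against μ,
  -- so half of it survives in the difference.
  have hmain : (1 / (k : ℝ)) ^ k * (1 / 4) ^ k ≤
      4 ^ k * (ε * Real.exp (lam * k / (8 * R ^ 2))) := by
    have : (1 / (k : ℝ)) ^ k * (2 * (1 / 4) ^ k) ≤ (1 / (k : ℝ)) ^ k * p := by gcongr
    rw [e4] at hup
    linarith
  rw [Real.exp_neg, ← div_eq_mul_inv, div_le_iff₀ (Real.exp_pos _)]
  calc (1 / (16 * (k : ℝ))) ^ k = (1 / 4) ^ k * ((1 / (k : ℝ)) ^ k * (1 / 4) ^ k) := by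
        rw [← mul_pow, ← mul_pow]; congr 1; field_simp; norm_num
    _ ≤ (1 / 4) ^ k * (4 ^ k * (ε * Real.exp (lam * k / (8 * R ^ 2)))) := by gcongr
    _ = ε * Real.exp (lam * k / (8 * R ^ 2)) := by
        rw [← mul_assoc, ← mul_pow]; norm_num

end scale


/-! ### The scale lower bound by projection to a line -/

lemma ae_norm_le_of_mem_mixingClass {R lmin lmax : ℝ} {X : Set (E d)}
    (hX : X ⊆ Metric.closedBall 0 R) {G : Measure (E d) × Matrix (Fin d) (Fin d) ℝ}
    (hG : G ∈ mixingClass d X lmin lmax) : ∀ᵐ x ∂G.1, ‖x‖ ≤ R := by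
  filter_upwards [G.1.support_mem_ae] with x hx
  simpa using hX (hG.2.1 hx)

lemma ae_abs_inner_map_le {R : ℝ} {P : Measure (E d)} (hP : ∀ᵐ x ∂P, ‖x‖ ≤ R) {v : E d}
    (hv : ‖v‖ = 1) : ∀ᵐ y ∂P.map (fun x => inner ℝ v x), |y| ≤ R := by
  rw [ae_map_iff (by fun_prop) (measurableSet_le (by fun_prop) (by fun_prop))]
  filter_upwards [hP] with x hx
  calc |inner ℝ v x| ≤ ‖v‖ * ‖x‖ := abs_real_inner_le_norm _ _
    _ ≤ R := by rw [hv, one_mul]; exact hx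

lemma charFun_map_inner (P : Measure (E d)) (v : E d) (r : ℝ) :
    charFun (P.map fun x => inner ℝ v x) r = charFun P (r • v) := by
  rw [charFun_apply, charFun_apply, integral_map (by fun_prop) (by fun_prop)]
  congr 1; ext x
  rw [inner_smul_right, real_inner_comm v x]
  simp

/-- Multiplying by exp(r² `quad S v` / 2) removes the Gaussian from the first mixture and leaves
variance τ in the second, at the price exp(lam r²/2). -/
lemma le_l1Dist_of_quad_lt {R lam : ℝ} (hR : 0 < R) (hlam : 0 ≤ lam) {P P' : Measure (E d)}
    [IsProbabilityMeasure P] [IsProbabilityMeasure P'] (hP : ∀ᵐ x ∂P, ‖x‖ ≤ R)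
    (hP' : ∀ᵐ x ∂P', ‖x‖ ≤ R) {S S' : Matrix (Fin d) (Fin d) ℝ} (hS : S.PosDef) (hS' : S'.PosDef)
    {v : E d} (hv : ‖v‖ = 1) (hSv : quad S v ≤ lam) {τ : ℝ} (hτ : 0 < τ)
    (hτS : quad S' v - quad S v = τ) {k : ℕ} (hk : 1 ≤ k)
    (hkp : 2 * (1 / 4) ^ k ≤ R / Real.sqrt (2 * Real.pi * τ) * Real.exp (-(18 * R ^ 2 / τ))) :
    (1 / (16 * k)) ^ k * Real.exp (-(lam * k / (8 * R ^ 2))) ≤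
      l1Dist (mixtureDensity (gaussianKern d) (P, S)) (mixtureDensity (gaussianKern d) (P', S')) := by
  have : IsProbabilityMeasure (P.map fun x => inner ℝ v x) :=
    Measure.isProbabilityMeasure_map (by fun_prop)
  have : IsProbabilityMeasure (P'.map fun x => inner ℝ v x) :=
    Measure.isProbabilityMeasure_map (by fun_prop)
  refine le_of_charFun_sub_le hR hτ hlam (l1Dist_nonneg _ _) (ae_abs_inner_map_le hP hv)
    (ae_abs_inner_map_le hP' hv) (fun r => ?_) hk hkp
  rw [charFun_map_inner, charFun_map_inner]
  have h := norm_charFun_sub_le (P := P) (P' := P') hS hS' (r • v)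
  set ε := l1Dist (mixtureDensity (gaussianKern d) (P, S)) (mixtureDensity (gaussianKern d) (P', S'))
  rw [quad_smul, quad_smul] at h
  set a := charFun P (r • v)
  set b := charFun P' (r • v)
  have hfac : a - b * ((Real.exp (-(τ * r ^ 2 / 2)) : ℝ) : ℂ) =
      (a * ((Real.exp (-(r ^ 2 * quad S v / 2)) : ℝ) : ℂ) -
        b * ((Real.exp (-(r ^ 2 * quad S' v / 2)) : ℝ) : ℂ)) *
          ((Real.exp (r ^ 2 * quad S v / 2) : ℝ) : ℂ) := by
    rw [sub_mul, mul_assoc, mul_assoc, ← Complex.ofReal_mul, ← Complex.ofReal_mul, ← Real.exp_add,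
      ← Real.exp_add, neg_add_cancel, Real.exp_zero, Complex.ofReal_one, mul_one, ← hτS]
    congr 4; ring
  rw [hfac, norm_mul, Complex.norm_real, Real.norm_of_nonneg (Real.exp_pos _).le]
  refine mul_le_mul h (Real.exp_le_exp.2 ?_) (Real.exp_pos _).le (l1Dist_nonneg _ _)
  nlinarith [sq_nonneg r]

/-- From 1/4 ≤ e⁻¹, the term 36R²/t in k beats the Gaussian exponent (τ ≥ t/2 doubles 18), and 2c₀
beats the prefactor through exp(-2c₀) ≤ 1/(2c₀). The additive constant and the rounding are turned
into a multiple of 1/t by t ≤ lmax. -/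
lemma exists_nat_two_mul_pow_le {R lmax : ℝ} (hR : 0 < R) (hmax : 0 < lmax) {t : ℝ} (ht : 0 < t)
    (htl : t ≤ lmax) :
    ∃ k : ℕ, 1 ≤ k ∧
      (k : ℝ) ≤ (36 * R ^ 2 + (2 * Real.sqrt (2 * Real.pi * lmax) / R + 1) * lmax) / t ∧
      ∀ τ, t / 2 ≤ τ → τ ≤ lmax →
        2 * (1 / 4) ^ k ≤ R / Real.sqrt (2 * Real.pi * τ) * Real.exp (-(18 * R ^ 2 / τ)) := by
  set c₀ := Real.sqrt (2 * Real.pi * lmax) / R with hc₀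
  have hc₀' : 0 < c₀ := by positivity
  have hx : 0 < 36 * R ^ 2 / t + 2 * c₀ := by positivity
  refine ⟨⌈36 * R ^ 2 / t + 2 * c₀⌉₊, Nat.one_le_iff_ne_zero.2 (Nat.ceil_pos.2 hx).ne', ?_,
    fun τ h1 h2 => ?_⟩
  · have := (Nat.ceil_lt_add_one hx.le).le
    refine this.trans ?_
    have h3 : 2 * c₀ + 1 ≤ (2 * c₀ + 1) * lmax / t := by
      rw [le_div_iff₀ ht]; gcongr
    rw [add_div, show 2 * Real.sqrt (2 * Real.pi * lmax) / R = 2 * c₀ by rw [hc₀]; ring]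
    linarith
  · set k := ⌈36 * R ^ 2 / t + 2 * c₀⌉₊
    have hk : 36 * R ^ 2 / t + 2 * c₀ ≤ k := Nat.le_ceil _
    have hτ : 0 < τ := by linarith
    have h4 : 18 * R ^ 2 / τ ≤ 36 * R ^ 2 / t := by
      rw [div_le_div_iff₀ hτ ht]; nlinarith [sq_nonneg R]
    have h5 : (1 / 4 : ℝ) ^ k ≤ Real.exp (-k) := by
      rw [show -(k : ℝ) = k * (-1 : ℝ) by ring, Real.exp_nat_mul]
      refine pow_le_pow_left₀ (by norm_num) ?_ k
      rw [Real.exp_neg, one_div]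
      exact inv_anti₀ (Real.exp_pos _) (by linarith [Real.exp_one_lt_d9])
    have h6 : Real.exp (-(k : ℝ)) ≤ Real.exp (-(18 * R ^ 2 / τ)) * Real.exp (-(2 * c₀)) := by
      rw [← Real.exp_add]; exact Real.exp_le_exp.2 (by linarith)
    have h7 : Real.exp (-(2 * c₀)) ≤ (2 * c₀)⁻¹ := by
      rw [Real.exp_neg]
      exact inv_anti₀ (by positivity) (by linarith [Real.add_one_le_exp (2 * c₀)])
    have h8 : c₀⁻¹ ≤ R / Real.sqrt (2 * Real.pi * τ) := by
      rw [hc₀, inv_div]; gcongr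
    calc 2 * (1 / 4 : ℝ) ^ k ≤ 2 * (Real.exp (-(18 * R ^ 2 / τ)) * (2 * c₀)⁻¹) := by
          gcongr
          exact h5.trans (h6.trans (by gcongr))
      _ = c₀⁻¹ * Real.exp (-(18 * R ^ 2 / τ)) := by field_simp
      _ ≤ _ := by gcongr

/-- The scale lower bound, up to lower order terms in the exponent. -/
lemma exists_exp_le_l1Dist {R lmin lmax : ℝ} (hR : 0 < R) (hmin : 0 < lmin) (hlt : lmin < lmax) :
    ∃ c > 0, ∃ b ≥ 0, ∀ (d : ℕ) (X : Set (E d)), X ⊆ Metric.closedBall 0 R →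
      ∀ G ∈ mixingClass d X lmin lmax, ∀ G' ∈ mixingClass d X lmin lmax,
        0 < opNorm (G.2 - G'.2) →
        Real.exp (-(c / opNorm (G.2 - G'.2) * (Real.log (1 / opNorm (G.2 - G'.2)) + b))) ≤
          l1Dist (mixtureDensity (gaussianKern d) G) (mixtureDensity (gaussianKern d) G') := by
  have hmax : 0 < lmax := hmin.trans hlt
  set c := 36 * R ^ 2 + (2 * Real.sqrt (2 * Real.pi * lmax) / R + 1) * lmax with hc
  have hc0 : 0 < c := by positivity
  -- Since k ≤ c/t, log(16k) ≤ log(1/t) + log(16c), and 16c dominates log(16c); the other summand is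
  -- the deconvolution cost per unit of k.
  refine ⟨c, hc0, 16 * c + lmax / (8 * R ^ 2), by positivity, fun d X hX G hG G' hG' ht => ?_⟩
  obtain ⟨P, S⟩ := G
  obtain ⟨P', S'⟩ := G'
  have : IsProbabilityMeasure P := hG.1
  have : IsProbabilityMeasure P' := hG'.1
  have hP : ∀ᵐ x ∂P, ‖x‖ ≤ R := ae_norm_le_of_mem_mixingClass hX hG
  have hP' : ∀ᵐ x ∂P', ‖x‖ ≤ R := ae_norm_le_of_mem_mixingClass hX hG'
  have hS : S ∈ spdBand d lmin lmax := hG.2.2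
  have hS' : S' ∈ spdBand d lmin lmax := hG'.2.2
  simp only at ht ⊢
  set t := opNorm (S - S') with htdef
  have htl : t ≤ lmax := opNorm_sub_le hmin hlt hS hS'
  obtain ⟨k, hk1, hkc, hk⟩ := exists_nat_two_mul_pow_le hR hmax ht htl
  rw [← hc] at hkc
  have hk0 : (0 : ℝ) < k := by exact_mod_cast hk1
  have hk1' : (1 : ℝ) ≤ k := by exact_mod_cast hk1
  have hlow : Real.exp (-(c / t * (Real.log (1 / t) + (16 * c + lmax / (8 * R ^ 2))))) ≤
      (1 / (16 * k)) ^ k * Real.exp (-(lmax * k / (8 * R ^ 2))) := by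
    have e1 : (1 / (16 * (k : ℝ))) ^ k = Real.exp (-(k * Real.log (16 * k))) := by
      rw [← Real.log_rpow (by positivity), ← Real.log_inv, Real.exp_log (by positivity),
        Real.rpow_natCast, one_div, inv_pow]
    rw [e1, ← Real.exp_add, Real.exp_le_exp]
    have hlog0 : 0 ≤ Real.log (16 * k) := Real.log_nonneg (by linarith)
    have hlog : Real.log (16 * k) ≤ Real.log (1 / t) + 16 * c := by
      calc Real.log (16 * k) ≤ Real.log (16 * c * (1 / t)) := by
            refine Real.log_le_log (by positivity) ?_
            calc 16 * (k : ℝ) ≤ 16 * (c / t) := by gcongr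
              _ = _ := by ring
        _ = Real.log (16 * c) + Real.log (1 / t) := Real.log_mul (by positivity) (by positivity)
        _ ≤ _ := by linarith [Real.log_le_sub_one_of_pos (by positivity : 0 < 16 * c)]
    have hβ : 0 ≤ lmax / (8 * R ^ 2) := by positivity
    have : k * (Real.log (16 * k) + lmax / (8 * R ^ 2)) ≤
        c / t * (Real.log (1 / t) + (16 * c + lmax / (8 * R ^ 2))) :=
      mul_le_mul hkc (by linarith) (by linarith) (by positivity)
    calc _ ≤ -(k * (Real.log (16 * k) + lmax / (8 * R ^ 2))) := neg_le_neg this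
      _ = _ := by ring
  refine hlow.trans ?_
  obtain ⟨v, hv, hq⟩ := exists_unit_le_abs_quad (hS.1.1.sub hS'.1.1) ht
  rw [← htdef] at hq
  have hq' : |quad (S - S') v| ≤ lmax := by
    have := abs_quad_le_opNorm (S - S') v
    rw [hv] at this; linarith
  have hSv : quad S v ≤ lmax := by simpa [hv] using quad_le hS v
  have hSv' : quad S' v ≤ lmax := by simpa [hv] using quad_le hS' v
  have hhk := hk _ hq hq'
  rw [quad_sub] at hq hq' hhk
  -- The matrix of smaller variance along v is the one deconvolved.
  rcases le_total (quad S v) (quad S' v) with hle | hle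
  · rw [abs_sub_comm, abs_of_nonneg (by linarith)] at hq hhk
    exact le_l1Dist_of_quad_lt hR hmax.le hP hP' hS.1 hS'.1 hv hSv
      (by linarith) rfl hk1 hhk
  · rw [abs_of_nonneg (by linarith)] at hq hhk
    rw [l1Dist_comm]
    exact le_l1Dist_of_quad_lt hR hmax.le hP' hP hS'.1 hS.1 hv hSv'
      (by linarith) rfl hk1 hhk

/-! ### The comparison function and its monotone extension -/

lemma strictMonoOn_gaussianPsi {M : ℝ} (hM : 0 < M) :
    StrictMonoOn (gaussianPsi M) (Icc 0 (Real.exp 1)) := by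
  -- The derivative is (log t - 1)/t², so e is exactly where monotonicity ends. The argument
  -- replaces it by log(x/y) < x/y - 1.
  have hlog : StrictAntiOn (fun t : ℝ => Real.log (1 / t) / t) (Ioc 0 (Real.exp 1)) := by
    intro x hx y hy hxy
    have h1 : Real.log (x / y) < x / y - 1 :=
      Real.log_lt_sub_one_of_pos (div_pos hx.1 hy.1)
        (by rw [Ne, div_eq_one_iff_eq hy.1.ne']; exact hxy.ne)
    rw [Real.log_div hx.1.ne' hy.1.ne', lt_sub_iff_add_lt, lt_div_iff₀ hy.1] at h1
    have h2 : Real.log y ≤ 1 := (Real.log_le_iff_le_exp hy.1).2 hy.2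
    simp only [one_div, Real.log_inv]
    rw [div_lt_div_iff₀ hy.1 hx.1]
    nlinarith [mul_nonneg (sub_nonneg.2 hxy.le) (sub_nonneg.2 h2)]
  intro x hx y hy hxy
  have hy0 : 0 < y := hx.1.trans_lt hxy
  unfold gaussianPsi
  rw [if_neg hy0.ne']
  split_ifs with h
  · exact Real.exp_pos _
  · have hx0 : 0 < x := lt_of_le_of_ne hx.1 (Ne.symm h)
    rw [Real.exp_lt_exp, neg_lt_neg_iff]
    exact mul_lt_mul_of_pos_left (hlog ⟨hx0, hx.2⟩ ⟨hy0, hy.2⟩ hxy) hM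

lemma gaussianPsi_nonneg (M t : ℝ) : 0 ≤ gaussianPsi M t := by
  unfold gaussianPsi; split_ifs <;> positivity

lemma one_le_gaussianPsi {M t : ℝ} (hM : 0 < M) (ht : 1 ≤ t) : 1 ≤ gaussianPsi M t := by
  rw [gaussianPsi, if_neg (by linarith), Real.one_le_exp_iff, one_div, Real.log_inv, neg_div,
    mul_neg, neg_neg]
  have := Real.log_nonneg ht
  positivity

/-- The scale lower bound holds with one exponent and one constant in all dimensions. -/
lemma exists_gaussianPsi_le_l1Dist {R lmin lmax : ℝ} (hR : 0 < R) (hmin : 0 < lmin)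
    (hlt : lmin < lmax) :
    ∃ M > 0, ∃ C > 0, ∀ (d : ℕ) (X : Set (E d)), X ⊆ Metric.closedBall 0 R →
      ∀ G ∈ mixingClass d X lmin lmax, ∀ G' ∈ mixingClass d X lmin lmax,
        C * gaussianPsi M (opNorm (G.2 - G'.2)) ≤
          l1Dist (mixtureDensity (gaussianKern d) G) (mixtureDensity (gaussianKern d) G') := by
  obtain ⟨c, hc, b, hb, h⟩ := exists_exp_le_l1Dist hR hmin hlt
  refine ⟨2 * c, by positivity, Real.exp (-(c * b * Real.exp b + c)), Real.exp_pos _,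
    fun d X hX G hG G' hG' => ?_⟩
  set t := opNorm (G.2 - G'.2) with ht
  have ht0 : 0 ≤ t := opNorm_nonneg _
  rcases ht0.eq_or_lt with h0 | h0
  · rw [← h0]; simpa [gaussianPsi] using l1Dist_nonneg _ _
  refine le_trans ?_ (h d X hX G hG G' hG' h0)
  rw [← ht, gaussianPsi, if_neg h0.ne', ← Real.exp_add, Real.exp_le_exp]
  -- Doubling c frees a second (c/t) log(1/t) to absorb cb/t. What remains is negative once log(1/t)
  -- ≥ b; otherwise 1/t ≤ exp b, and log t ≤ t bounds it.
  have key : c / t * (b - Real.log (1 / t)) ≤ c * b * Real.exp b + c := by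
    rcases le_total b (Real.log (1 / t)) with hbl | hbl
    · have : c / t * (b - Real.log (1 / t)) ≤ 0 :=
        mul_nonpos_of_nonneg_of_nonpos (by positivity) (by linarith)
      have : 0 ≤ c * b * Real.exp b + c := by positivity
      linarith
    · have h1 : 1 / t ≤ Real.exp b := (Real.log_le_iff_le_exp (by positivity)).1 hbl
      have h2 : -Real.log (1 / t) ≤ t := by
        rw [one_div, Real.log_inv, neg_neg]
        linarith [Real.log_le_sub_one_of_pos h0]
      calc c / t * (b - Real.log (1 / t)) ≤ c / t * (b + t) := by gcongr; linarith
        _ = c * b * (1 / t) + c := by field_simp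
        _ ≤ _ := by gcongr
  have e : 2 * c * (Real.log (1 / t) / t) - c / t * (Real.log (1 / t) + b) =
      -(c / t * (b - Real.log (1 / t))) := by ring
  linarith

/-- A strictly increasing extension of `gaussianPsi M` beyond `[0, e]`. -/
noncomputable def gaussianPsiExt (M t : ℝ) : ℝ :=
  if t ≤ Real.exp 1 then gaussianPsi M t else gaussianPsi M (Real.exp 1) + (t - Real.exp 1)

lemma eqOn_gaussianPsiExt (M : ℝ) :
    EqOn (gaussianPsiExt M) (gaussianPsi M) (Icc 0 (Real.exp 1)) := fun _ ht => if_pos ht.2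

lemma strictMonoOn_gaussianPsiExt {M : ℝ} (hM : 0 < M) :
    StrictMonoOn (gaussianPsiExt M) (Ici 0) := by
  intro x hx y hy hxy
  have hmono := strictMonoOn_gaussianPsi hM
  have he : Real.exp 1 ∈ Icc 0 (Real.exp 1) := ⟨(Real.exp_pos 1).le, le_rfl⟩
  unfold gaussianPsiExt
  split_ifs with h1 h2 h2
  · exact hmono ⟨hx, h1⟩ ⟨hy, h2⟩ hxy
  · have := hmono.monotoneOn ⟨hx, h1⟩ he h1
    linarith
  · linarith
  · linarith

lemma mapsTo_gaussianPsiExt (M : ℝ) : MapsTo (gaussianPsiExt M) (Ici 0) (Ici 0) := by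
  intro x _
  have := gaussianPsi_nonneg M
  unfold gaussianPsiExt
  simp only [mem_Ici]
  split_ifs with h
  · exact this _
  · linarith [this (Real.exp 1)]

/-- Beyond e the linear extension is bounded on t ≤ T, whereas `gaussianPsi M` stays at least 1
there, so a constant factor suffices. -/
lemma exists_gaussianPsiExt_le {M T : ℝ} (hM : 0 < M) (hT : 0 < T) :
    ∃ c > 0, ∀ t ≤ T, c * gaussianPsiExt M t ≤ gaussianPsi M t := by
  have he := gaussianPsi_nonneg M (Real.exp 1)
  refine ⟨(1 + gaussianPsi M (Real.exp 1) + T)⁻¹, by positivity, fun t ht => ?_⟩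
  rw [inv_mul_le_iff₀ (by positivity)]
  unfold gaussianPsiExt
  split_ifs with h
  · have := gaussianPsi_nonneg M t
    nlinarith [mul_nonneg he this]
  · have h1 := one_le_gaussianPsi hM (t := t) (by linarith [Real.add_one_le_exp 1])
    have := Real.exp_pos 1
    calc _ ≤ (1 + gaussianPsi M (Real.exp 1) + T) * 1 := by linarith
      _ ≤ _ := by gcongr


/-! ### Coupling two measures piece by piece -/

section coupling

variable {X J : Type*} [MeasurableSpace X] [Fintype J]

lemma smul_min_div_add (α : Measure X) [IsFiniteMeasure α] (b : ℝ≥0∞) :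
    (min (α univ) b * (α univ)⁻¹) • α + (1 - min (α univ) b * (α univ)⁻¹) • α = α := by
  rw [← add_smul, add_tsub_cancel_of_le, one_smul]
  calc min (α univ) b * (α univ)⁻¹ ≤ α univ * (α univ)⁻¹ := by gcongr; exact min_le_left _ _
    _ ≤ 1 := ENNReal.mul_inv_le_one _

lemma one_sub_min_div_mul (a b : ℝ≥0∞) (ha : a ≠ ∞) :
    (1 - min a b * a⁻¹) * a = a - b := by
  rcases eq_or_ne a 0 with rfl | h0
  · simp
  rw [ENNReal.sub_mul (fun _ _ => ha), one_mul, mul_assoc, ENNReal.inv_mul_cancel h0 ha, mul_one]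
  rcases le_total a b with h | h
  · simp [h, tsub_eq_zero_of_le h]
  · simp [h]

/-- The part of `α` that exceeds a mass `b`. -/
noncomputable def excess (α : Measure X) (b : ℝ≥0∞) : Measure X :=
  (1 - min (α univ) b * (α univ)⁻¹) • α

lemma excess_univ (α : Measure X) [IsFiniteMeasure α] (b : ℝ≥0∞) :
    excess α b univ = α univ - b := by
  rw [excess, Measure.smul_apply, smul_eq_mul, one_sub_min_div_mul _ _ (measure_ne_top _ _)]

/-- The left factor is the weight of the first marginal of the normalized product coupling. The
cancellation survives β = 0 because the minimum is then 0. -/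
lemma min_mul_inv_mul_smul (α β : Measure X) [IsFiniteMeasure α] [IsFiniteMeasure β] :
    (min (α univ) (β univ) * (α univ * β univ)⁻¹ * β univ) • α =
      (min (α univ) (β univ) * (α univ)⁻¹) • α := by
  rcases eq_or_ne (β univ) 0 with h0 | h0
  · simp [h0]
  congr 1
  rw [ENNReal.mul_inv (.inr (measure_ne_top _ _)) (.inl (measure_ne_top _ _)), mul_assoc, mul_assoc,
    ENNReal.inv_mul_cancel h0 (measure_ne_top _ _), mul_one]

/-- Within each index the common mass min(a_j, b_j) is coupled by a normalized product, whose
marginals are at most α_j and β_j, so the f_j integrate to the first sum. The excesses have equal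
total mass and are coupled by a product at cost at most D per unit. -/
lemma exists_coupling (α β : J → Measure X) [∀ j, IsFiniteMeasure (α j)]
    [∀ j, IsFiniteMeasure (β j)] (hab : ∑ j, α j univ = ∑ j, β j univ) :
    ∃ π : Measure (X × X), π.map Prod.fst = ∑ j, α j ∧ π.map Prod.snd = ∑ j, β j ∧
      ∀ (c : X × X → ℝ≥0∞) (f : J → X → ℝ≥0∞) (D : ℝ≥0∞) (B : Set X), Measurable c →
        (∀ j, Measurable (f j)) → (∀ j, ∀ᵐ x ∂α j, x ∈ B) → (∀ j, ∀ᵐ x ∂β j, x ∈ B) →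
        (∀ j, ∀ x ∈ B, ∀ y ∈ B, c (x, y) ≤ f j x + f j y) →
        (∀ x ∈ B, ∀ y ∈ B, c (x, y) ≤ D) →
        ∫⁻ z, c z ∂π ≤ ∑ j, (∫⁻ x, f j x ∂α j + ∫⁻ x, f j x ∂β j) +
          D * ∑ j, (α j univ - β j univ) := by
  set a : J → ℝ≥0∞ := fun j => α j univ with ha
  set b : J → ℝ≥0∞ := fun j => β j univ with hb
  have ha_top : ∀ j, a j ≠ ∞ := fun j => measure_ne_top _ _
  have hb_top : ∀ j, b j ≠ ∞ := fun j => measure_ne_top _ _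
  set ρ : Measure X := ∑ j, excess (α j) (b j) with hρ
  set ρ' : Measure X := ∑ j, excess (β j) (a j) with hρ'
  set s : ℝ≥0∞ := ∑ j, (a j - b j) with hs
  have hρs : ρ univ = s := by
    simp only [hρ, Measure.finsetSum_apply, excess_univ]; rfl
  have hρ's : ρ' univ = s := by
    have h1 : ρ' univ = ∑ j, (b j - a j) := by
      simp only [hρ', Measure.finsetSum_apply, excess_univ]; rfl
    have h2 : ∑ j, (a j - b j) + ∑ j, min (a j) (b j) = ∑ j, (b j - a j) + ∑ j, min (a j) (b j) := by
      rw [← Finset.sum_add_distrib, ← Finset.sum_add_distrib]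
      simp_rw [tsub_add_min]
      rw [hab]
      refine Finset.sum_congr rfl fun j _ => ?_
      rw [min_comm, tsub_add_min]
    rw [h1]
    refine ((ENNReal.add_left_inj ?_).1 h2).symm
    exact ENNReal.sum_ne_top.2 fun j _ => ne_top_of_le_ne_top (ha_top j) (min_le_left _ _)
  have hs_top : s ≠ ∞ := ENNReal.sum_ne_top.2 fun j _ => ne_top_of_le_ne_top (ha_top j) tsub_le_self
  have : IsFiniteMeasure ρ := ⟨by rw [hρs]; exact hs_top.lt_top⟩
  have : IsFiniteMeasure ρ' := ⟨by rw [hρ's]; exact hs_top.lt_top⟩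
  -- If s = 0 then s⁻¹ * s is 0 rather than 1, but σ is then the zero measure.
  have hcancel : ∀ (σ : Measure X), σ univ = s → (s⁻¹ * s) • σ = σ := by
    intro σ hσ
    rcases eq_or_ne s 0 with h0 | h0
    · rw [h0, Measure.measure_univ_eq_zero] at hσ
      simp [hσ]
    · rw [ENNReal.inv_mul_cancel h0 hs_top, one_smul]
  set w : J → ℝ≥0∞ := fun j => min (a j) (b j) * (a j * b j)⁻¹ with hw
  have hwb : ∀ j, (w j * b j) • α j + excess (α j) (b j) = α j := fun j => by
    have h := min_mul_inv_mul_smul (α j) (β j)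
    rw [show (w j * b j) • α j = _ from h]
    exact smul_min_div_add (α j) (b j)
  have hwa : ∀ j, (w j * a j) • β j + excess (β j) (a j) = β j := fun j => by
    have h := min_mul_inv_mul_smul (β j) (α j)
    rw [min_comm, mul_comm (β j univ)] at h
    rw [show (w j * a j) • β j = _ from h, min_comm]
    exact smul_min_div_add (β j) (a j)
  refine ⟨∑ j, w j • (α j).prod (β j) + s⁻¹ • ρ.prod ρ', ?_, ?_, ?_⟩
  · rw [Measure.map_add _ _ measurable_fst, Measure.map_smul, Measure.map_fst_prod, hρ's, smul_smul,
      hcancel ρ hρs, hρ, Measure.map_finset_sum measurable_fst.aemeasurable,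
      ← Finset.sum_add_distrib]
    refine Finset.sum_congr rfl fun j _ => ?_
    rw [Measure.map_smul, Measure.map_fst_prod, smul_smul]
    exact hwb j
  · rw [Measure.map_add _ _ measurable_snd, Measure.map_smul, Measure.map_snd_prod, hρs, smul_smul,
      hcancel ρ' hρ's, hρ', Measure.map_finset_sum measurable_snd.aemeasurable,
      ← Finset.sum_add_distrib]
    refine Finset.sum_congr rfl fun j _ => ?_
    rw [Measure.map_smul, Measure.map_snd_prod, smul_smul]
    exact hwa j
  · intro c f D B hc hf hαB hβB hcf hcD
    rw [lintegral_add_measure, lintegral_finsetSum_measure, lintegral_smul_measure]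
    refine add_le_add (Finset.sum_le_sum fun j _ => ?_) ?_
    · rw [lintegral_smul_measure, lintegral_prod _ hc.aemeasurable, smul_eq_mul]
      calc w j * ∫⁻ x, ∫⁻ y, c (x, y) ∂β j ∂α j
          ≤ w j * ∫⁻ x, ∫⁻ y, (f j x + f j y) ∂β j ∂α j := by
            gcongr 1
            refine lintegral_mono_ae ?_
            filter_upwards [hαB j] with x hx
            refine lintegral_mono_ae ?_
            filter_upwards [hβB j] with y hy
            exact hcf j x hx y hy
        _ = (w j * b j) * ∫⁻ x, f j x ∂α j + (w j * a j) * ∫⁻ x, f j x ∂β j := by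
            have h1 : ∀ x, ∫⁻ y, (f j x + f j y) ∂β j = f j x * b j + ∫⁻ y, f j y ∂β j := by
              intro x
              rw [lintegral_add_left measurable_const, lintegral_const]
            simp_rw [h1]
            rw [lintegral_add_left ((hf j).mul_const _), lintegral_mul_const _ (hf j),
              lintegral_const]
            ring
        _ ≤ 1 * ∫⁻ x, f j x ∂α j + 1 * ∫⁻ x, f j x ∂β j := by
            have hle : (a j * b j)⁻¹ * (a j * b j) ≤ 1 := ENNReal.inv_mul_le_one _
            gcongr
            · calc w j * b j ≤ a j * (a j * b j)⁻¹ * b j := by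
                    simp only [hw]; gcongr; exact min_le_left _ _
                _ = (a j * b j)⁻¹ * (a j * b j) := by ring
                _ ≤ 1 := hle
            · calc w j * a j ≤ b j * (a j * b j)⁻¹ * a j := by
                    simp only [hw]; gcongr; exact min_le_right _ _
                _ = (a j * b j)⁻¹ * (a j * b j) := by ring
                _ ≤ 1 := hle
        _ = _ := by simp
    · have hρB : ∀ᵐ x ∂ρ, x ∈ B := by
        rw [ae_iff, hρ, Measure.finsetSum_apply]
        refine Finset.sum_eq_zero fun j _ => ?_
        rw [excess, Measure.smul_apply, ae_iff.1 (hαB j), smul_zero]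
      have hρ'B : ∀ᵐ x ∂ρ', x ∈ B := by
        rw [ae_iff, hρ', Measure.finsetSum_apply]
        refine Finset.sum_eq_zero fun j _ => ?_
        rw [excess, Measure.smul_apply, ae_iff.1 (hβB j), smul_zero]
      rw [lintegral_prod _ hc.aemeasurable, smul_eq_mul]
      calc s⁻¹ * ∫⁻ x, ∫⁻ y, c (x, y) ∂ρ' ∂ρ ≤ s⁻¹ * ∫⁻ x, ∫⁻ y, D ∂ρ' ∂ρ := by
            gcongr 1
            refine lintegral_mono_ae ?_
            filter_upwards [hρB] with x hx
            refine lintegral_mono_ae ?_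
            filter_upwards [hρ'B] with y hy
            exact hcD x hx y hy
        _ = D * s * (s⁻¹ * s) := by
            rw [lintegral_const, lintegral_const, hρs, hρ's]; ring
        _ ≤ D * s * 1 := by gcongr; exact ENNReal.inv_mul_le_one _
        _ = _ := by rw [mul_one]

end coupling

/-! ### Wasserstein distance and partitions of unity -/

section wasserstein

variable {J : Type*} [Fintype J]

/-- A partition of unity whose members are concentrated bounds the Wasserstein distance of two
measures in terms of its integrals. -/
lemma W1_le_of_partition {P P' : Measure (E d)} [IsProbabilityMeasure P] [IsProbabilityMeasure P']
    {R κ : ℝ} (hR : 0 ≤ R) (hP : ∀ᵐ x ∂P, ‖x‖ ≤ R) (hP' : ∀ᵐ x ∂P', ‖x‖ ≤ R)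
    {ψ F : J → E d → ℝ} (hψc : ∀ j, Continuous (ψ j)) (hFc : ∀ j, Continuous (F j))
    (hψ0 : ∀ j x, 0 ≤ ψ j x) (hF0 : ∀ j x, 0 ≤ F j x) (hψ1 : ∀ x, ∑ j, ψ j x = 1)
    (hdist : ∀ j x y, ‖x‖ ≤ R → ‖y‖ ≤ R → dist x y ≤ F j x + F j y)
    (hκ : ∀ x, ∑ j, ψ j x * F j x ≤ κ) :
    W1 P P' ≤ 2 * κ + 2 * R * ∑ j, |∫ x, ψ j x ∂P - ∫ x, ψ j x ∂P'| := by
  have hκ0 : 0 ≤ κ :=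
    (Finset.sum_nonneg fun j _ => mul_nonneg (hψ0 j 0) (hF0 j 0)).trans (hκ 0)
  have hψle : ∀ j x, ψ j x ≤ 1 := fun j x => by
    rw [← hψ1 x]
    exact Finset.single_le_sum (f := fun j => ψ j x) (fun i _ => hψ0 i x) (Finset.mem_univ j)
  have hψm : ∀ j, Measurable fun x => ENNReal.ofReal (ψ j x) := fun j =>
    (hψc j).measurable.ennreal_ofReal
  have hFm : ∀ j, Measurable fun x => ENNReal.ofReal (F j x) := fun j =>
    (hFc j).measurable.ennreal_ofReal
  have hpart : ∀ Q : Measure (E d), ∑ j, Q.withDensity (fun x => ENNReal.ofReal (ψ j x)) = Q := by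
    intro Q
    ext s hs
    simp_rw [Measure.finsetSum_apply, withDensity_apply _ hs]
    rw [← lintegral_finsetSum _ fun j _ => hψm j]
    simp_rw [← ENNReal.ofReal_sum_of_nonneg fun j _ => hψ0 j _, hψ1]
    simp
  have hint : ∀ (Q : Measure (E d)) [IsProbabilityMeasure Q] j, Integrable (ψ j) Q := fun Q _ j =>
    integrable_of_abs_le (hψc j).aestronglyMeasurable (c := 1) fun x => by
      rw [abs_of_nonneg (hψ0 j x)]; exact hψle j x
  have hmass : ∀ (Q : Measure (E d)) [IsProbabilityMeasure Q] j,
      Q.withDensity (fun x => ENNReal.ofReal (ψ j x)) univ = ENNReal.ofReal (∫ x, ψ j x ∂Q) := by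
    intro Q _ j
    rw [withDensity_apply _ MeasurableSet.univ, setLIntegral_univ,
      ofReal_integral_eq_lintegral_ofReal (hint Q j) (.of_forall (hψ0 j))]
  have hfin : ∀ (Q : Measure (E d)) [IsProbabilityMeasure Q] j,
      IsFiniteMeasure (Q.withDensity fun x => ENNReal.ofReal (ψ j x)) := fun Q _ j =>
    ⟨by rw [hmass]; exact ENNReal.ofReal_lt_top⟩
  have hfP := hfin P
  have hfP' := hfin P'
  -- The pieces are the measures with densities ψ_j; κ bounds the cost of the matched mass once for
  -- each of P and P', and 2R is the diameter paid by unmatched mass.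
  obtain ⟨π, h1, h2, h3⟩ := exists_coupling
    (fun j => P.withDensity fun x => ENNReal.ofReal (ψ j x))
    (fun j => P'.withDensity fun x => ENNReal.ofReal (ψ j x)) (by
      rw [← Measure.finsetSum_apply, ← Measure.finsetSum_apply, hpart, hpart]
      simp)
  rw [hpart] at h1 h2
  have hsum : ∀ (Q : Measure (E d)) [IsProbabilityMeasure Q],
      ∑ j, ∫⁻ x, ENNReal.ofReal (F j x) ∂Q.withDensity (fun x => ENNReal.ofReal (ψ j x)) ≤
        ENNReal.ofReal κ := by
    intro Q _
    calc _ = ∑ j, ∫⁻ x, ENNReal.ofReal (ψ j x * F j x) ∂Q := by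
          refine Finset.sum_congr rfl fun j _ => ?_
          rw [lintegral_withDensity_eq_lintegral_mul _ (hψm j) (hFm j)]
          refine lintegral_congr fun x => ?_
          rw [Pi.mul_apply, ENNReal.ofReal_mul (hψ0 j x)]
      _ = ∫⁻ x, ENNReal.ofReal (∑ j, ψ j x * F j x) ∂Q := by
          rw [← lintegral_finsetSum _ fun j _ =>
            show Measurable fun x => ENNReal.ofReal (ψ j x * F j x) from
              ((hψc j).mul (hFc j)).measurable.ennreal_ofReal]
          refine lintegral_congr fun x => ?_
          rw [ENNReal.ofReal_sum_of_nonneg fun j _ => mul_nonneg (hψ0 j x) (hF0 j x)]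
      _ ≤ ∫⁻ _, ENNReal.ofReal κ ∂Q :=
          lintegral_mono fun x => ENNReal.ofReal_le_ofReal (hκ x)
      _ = ENNReal.ofReal κ := by simp
  have hcost := h3 (fun z => edist z.1 z.2) (fun j x => ENNReal.ofReal (F j x))
    (ENNReal.ofReal (2 * R)) {x | ‖x‖ ≤ R} (by fun_prop) hFm
    (fun j => (withDensity_absolutelyContinuous _ _).ae_le hP)
    (fun j => (withDensity_absolutelyContinuous _ _).ae_le hP')
    (fun j x hx y hy => by
      rw [edist_dist, ← ENNReal.ofReal_add (hF0 j x) (hF0 j y)]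
      exact ENNReal.ofReal_le_ofReal (hdist j x y hx hy))
    (fun x hx y hy => by
      rw [edist_dist]
      refine ENNReal.ofReal_le_ofReal ?_
      have := dist_le_norm_add_norm x y
      simp only [mem_ofPred_eq] at hx hy
      linarith)
  have hS0 : 0 ≤ ∑ j, |∫ x, ψ j x ∂P - ∫ x, ψ j x ∂P'| :=
    Finset.sum_nonneg fun _ _ => abs_nonneg _
  have hbound : ∫⁻ z, edist z.1 z.2 ∂π ≤
      ENNReal.ofReal (2 * κ + 2 * R * ∑ j, |∫ x, ψ j x ∂P - ∫ x, ψ j x ∂P'|) := by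
    refine hcost.trans ?_
    rw [Finset.sum_add_distrib, ENNReal.ofReal_add (by positivity) (by positivity), two_mul κ,
      ENNReal.ofReal_add hκ0 hκ0, ENNReal.ofReal_mul (p := 2 * R) (by positivity)]
    refine add_le_add (add_le_add (hsum P) (hsum P')) (mul_le_mul_right ?_ _)
    rw [ENNReal.ofReal_sum_of_nonneg fun _ _ => abs_nonneg _]
    refine Finset.sum_le_sum fun j _ => ?_
    rw [hmass, hmass, ← ENNReal.ofReal_sub _ (integral_nonneg (hψ0 j))]
    exact ENNReal.ofReal_le_ofReal (le_abs_self _)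
  unfold W1
  refine ENNReal.toReal_le_of_le_ofReal (by positivity) (le_trans ?_ hbound)
  exact iInf₂_le π ⟨h1, h2⟩

lemma W1_nonneg (P P' : Measure (E d)) : 0 ≤ W1 P P' := ENNReal.toReal_nonneg

lemma W1_le_two_mul {P P' : Measure (E d)} [IsProbabilityMeasure P] [IsProbabilityMeasure P']
    {R : ℝ} (hR : 0 ≤ R) (hP : ∀ᵐ x ∂P, ‖x‖ ≤ R) (hP' : ∀ᵐ x ∂P', ‖x‖ ≤ R) :
    W1 P P' ≤ 2 * R := by
  have := W1_le_of_partition (J := Unit) (ψ := fun _ _ => 1) (F := fun _ _ => R) (κ := R) hR hP hP'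
    (fun _ => continuous_const) (fun _ => continuous_const) (by simp) (by simp [hR]) (by simp)
    (fun _ x y hx hy => (dist_le_norm_add_norm x y).trans (add_le_add hx hy)) (by simp)
  simpa using this

end wasserstein


/-! ### Bernstein partitions of unity made of trigonometric polynomials -/

section bernstein

/-- The Bernstein basis as functions on the real line. -/
noncomputable def bern (n k : ℕ) (y : ℝ) : ℝ := n.choose k * y ^ k * (1 - y) ^ (n - k)

lemma bern_nonneg {y : ℝ} (h0 : 0 ≤ y) (h1 : y ≤ 1) (n k : ℕ) : 0 ≤ bern n k y := by
  have : 0 ≤ 1 - y := by linarith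
  unfold bern; positivity

lemma sum_bern {y : ℝ} (h0 : 0 ≤ y) (h1 : y ≤ 1) (n : ℕ) : ∑ k : Fin (n + 1), bern n k y = 1 := by
  simpa [bernstein_apply, bern] using bernstein.probability n ⟨y, h0, h1⟩

lemma sum_bern_mul_sq {y : ℝ} (h0 : 0 ≤ y) (h1 : y ≤ 1) {n : ℕ} (hn : n ≠ 0) :
    ∑ k : Fin (n + 1), bern n k y * (y - k / n) ^ 2 = y * (1 - y) / n := by
  rw [← bernstein.variance hn ⟨y, h0, h1⟩]
  refine Finset.sum_congr rfl fun k _ => ?_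
  rw [bernstein_apply, mul_comm]; rfl

/-- A coordinate of Euclidean space folded into `[0, 1]` by the sine. -/
noncomputable def sinCoord (R : ℝ) (x : E d) (i : Fin d) : ℝ := (1 + Real.sin (x i / R)) / 2

lemma continuous_sinCoord (R : ℝ) (i : Fin d) : Continuous fun x : E d => sinCoord R x i := by
  unfold sinCoord; fun_prop

lemma sinCoord_nonneg (R : ℝ) (x : E d) (i : Fin d) : 0 ≤ sinCoord R x i := by
  unfold sinCoord; linarith [Real.neg_one_le_sin (x i / R)]

lemma sinCoord_le_one (R : ℝ) (x : E d) (i : Fin d) : sinCoord R x i ≤ 1 := by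
  unfold sinCoord; linarith [Real.sin_le_one (x i / R)]

/-- In sin u - sin v = 2 sin((u-v)/2) cos((u+v)/2) the cosine is at least 1/2, and Jordan's
inequality handles the sine. Folding coordinates by the sine thus distorts distances on the ball by
a bounded factor only. -/
lemma abs_sub_le_four_mul_abs_sin_sub {u v : ℝ} (hu : |u| ≤ 1) (hv : |v| ≤ 1) :
    |u - v| ≤ 4 * |Real.sin u - Real.sin v| := by
  wlog h : v ≤ u generalizing u v
  · rw [abs_sub_comm, abs_sub_comm (Real.sin u)]; exact this hv hu (le_of_not_ge h)
  rw [abs_le] at hu hv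
  have hpi := Real.pi_gt_three
  have h1 : 2 / Real.pi * ((u - v) / 2) ≤ Real.sin ((u - v) / 2) :=
    Real.mul_le_sin (by linarith) (by linarith)
  have h2 : 1 / 2 ≤ Real.cos ((u + v) / 2) := by
    have := Real.one_sub_sq_div_two_le_cos (x := (u + v) / 2)
    nlinarith
  have h3 : (u - v) / 4 ≤ 2 / Real.pi * ((u - v) / 2) := by
    rw [show 2 / Real.pi * ((u - v) / 2) = (u - v) / Real.pi by ring]
    have := Real.pi_le_four
    gcongr
  have h4 : (u - v) / 4 ≤ Real.sin u - Real.sin v := by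
    rw [Real.sin_sub_sin]
    nlinarith
  rw [abs_of_nonneg (by linarith : 0 ≤ u - v)]
  linarith [le_abs_self (Real.sin u - Real.sin v)]

lemma dist_sq_le_sinCoord {R : ℝ} (hR : 0 < R) {x y : E d} (hx : ‖x‖ ≤ R) (hy : ‖y‖ ≤ R) :
    dist x y ^ 2 ≤ 64 * R ^ 2 * ∑ i, (sinCoord R x i - sinCoord R y i) ^ 2 := by
  have hcoord : ∀ {z : E d}, ‖z‖ ≤ R → ∀ i, |z i / R| ≤ 1 := fun {z} hz i => by
    rw [abs_div, abs_of_pos hR, div_le_one hR]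
    exact (by simpa using PiLp.norm_apply_le z i : |z i| ≤ ‖z‖).trans hz
  rw [EuclideanSpace.dist_eq, Real.sq_sqrt (Finset.sum_nonneg fun _ _ => sq_nonneg _),
    Finset.mul_sum]
  refine Finset.sum_le_sum fun i _ => ?_
  have h := abs_sub_le_four_mul_abs_sin_sub (hcoord hx i) (hcoord hy i)
  have h1 : dist (x i) (y i) ≤ 8 * R * |sinCoord R x i - sinCoord R y i| := by
    rw [Real.dist_eq, sinCoord, sinCoord, ← sub_div, abs_div, abs_two, add_sub_add_left_eq_sub]
    rw [← sub_div, abs_div, abs_of_pos hR, div_le_iff₀ hR] at h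
    linarith
  calc dist (x i) (y i) ^ 2 ≤ (8 * R * |sinCoord R x i - sinCoord R y i|) ^ 2 := by gcongr
    _ = 64 * R ^ 2 * (sinCoord R x i - sinCoord R y i) ^ 2 := by rw [mul_pow, sq_abs]; ring

/-- Products of Bernstein polynomials in the folded coordinates. -/
noncomputable def trigBern (R : ℝ) (n : ℕ) (j : Fin d → Fin (n + 1)) (x : E d) : ℝ :=
  ∏ i, bern n (j i) (sinCoord R x i)

lemma continuous_trigBern (R : ℝ) (n : ℕ) (j : Fin d → Fin (n + 1)) :
    Continuous (trigBern R n j) := by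
  have := continuous_sinCoord (d := d) R
  unfold trigBern bern; fun_prop

lemma trigBern_nonneg (R : ℝ) (n : ℕ) (j : Fin d → Fin (n + 1)) (x : E d) :
    0 ≤ trigBern R n j x :=
  Finset.prod_nonneg fun i _ => bern_nonneg (sinCoord_nonneg R x i) (sinCoord_le_one R x i) _ _

lemma sum_prod_pi {n : ℕ} (f : Fin d → Fin n → ℝ) :
    ∑ j : Fin d → Fin n, ∏ i, f i (j i) = ∏ i, ∑ k, f i k := by
  rw [Finset.prod_univ_sum, Fintype.piFinset_univ]

lemma sum_trigBern (R : ℝ) (n : ℕ) (x : E d) : ∑ j, trigBern R n j x = 1 := by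
  unfold trigBern
  rw [sum_prod_pi fun i k => bern n k (sinCoord R x i)]
  exact Finset.prod_eq_one fun i _ => sum_bern (sinCoord_nonneg R x i) (sinCoord_le_one R x i) n

/-- For fixed x the weights are a product of binomial laws, so only the coordinate i₀ matters in
each term, with variance y(1-y)/n ≤ 1/(4n). -/
lemma sum_trigBern_mul_sq (R : ℝ) {n : ℕ} (hn : n ≠ 0) (x : E d) :
    ∑ j, trigBern R n j x * ∑ i, (sinCoord R x i - (j i : ℕ) / n) ^ 2 ≤ d / (4 * n) := by
  classical
  simp_rw [Finset.mul_sum]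
  rw [Finset.sum_comm]
  have hterm : ∀ i₀ : Fin d,
      ∑ j, trigBern R n j x * (sinCoord R x i₀ - (j i₀ : ℕ) / n) ^ 2 ≤ 1 / (4 * n) := by
    intro i₀
    have h0 := fun i => sinCoord_nonneg R x i
    have h1 := fun i => sinCoord_le_one R x i
    have e : ∀ j : Fin d → Fin (n + 1),
        trigBern R n j x * (sinCoord R x i₀ - (j i₀ : ℕ) / n) ^ 2 =
        ∏ i, (bern n (j i) (sinCoord R x i) *
          if i = i₀ then (sinCoord R x i - (j i : ℕ) / n) ^ 2 else 1) := by
      intro j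
      rw [Finset.prod_mul_distrib, Finset.prod_ite_eq' Finset.univ i₀]
      simp [trigBern]
    simp_rw [e]
    rw [sum_prod_pi fun i k => bern n k (sinCoord R x i) *
      if i = i₀ then (sinCoord R x i - (k : ℕ) / n) ^ 2 else 1]
    rw [Finset.prod_eq_single i₀]
    · simp only [if_true]
      rw [sum_bern_mul_sq (h0 _) (h1 _) hn]
      have hn' : (0 : ℝ) < n := by positivity
      rw [div_le_div_iff₀ hn' (by positivity)]
      nlinarith [sq_nonneg (2 * sinCoord R x i₀ - 1)]
    · intro i _ hi
      simp only [if_neg hi, mul_one]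
      exact sum_bern (h0 i) (h1 i) n
    · simp
  calc _ ≤ ∑ _ : Fin d, 1 / (4 * (n : ℝ)) := Finset.sum_le_sum fun i _ => hterm i
    _ = d / (4 * n) := by simp [div_eq_mul_inv]

/-- Both (1 + sin)/2 and (1 - sin)/2 have coefficient sum at most 1, so their powers are free and
only the binomial coefficients are paid. Each coordinate contributes frequency n/R. -/
lemma isTrigPoly_trigBern {R : ℝ} (hR : 0 < R) (n : ℕ) (j : Fin d → Fin (n + 1)) :
    IsTrigPoly (fun x : E d => ((trigBern R n j x : ℝ) : ℂ)) (∏ i, (n.choose (j i) : ℝ))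
      (d * (n / R)) := by
  have hsin : ∀ i, IsTrigPoly (fun x : E d => ((Real.sin (x i / R) : ℝ) : ℂ)) 1 R⁻¹ := fun i => by
    have := isTrigPoly_sin (R⁻¹ • EuclideanSpace.single i (1 : ℝ) : E d)
    convert this using 1
    · ext x
      rw [inner_smul_right, EuclideanSpace.inner_single_right]
      simp [div_eq_inv_mul]
    · rw [norm_smul]; simp [abs_of_pos hR]
  have h1 : ∀ i, IsTrigPoly (fun x : E d => ((sinCoord R x i : ℝ) : ℂ)) 1 R⁻¹ := fun i => by
    convert ((IsTrigPoly.const (V := E d) (1 / 2)).add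
      ((IsTrigPoly.const (V := E d) (1 / 2)).mul (hsin i))).mono (K' := 1) (r' := R⁻¹)
      (by norm_num) (by simp [hR.le]) using 2 with x
    rw [sinCoord]; push_cast; ring
  have h2 : ∀ i, IsTrigPoly (fun x : E d => ((1 - sinCoord R x i : ℝ) : ℂ)) 1 R⁻¹ := fun i => by
    convert ((IsTrigPoly.const (V := E d) (1 / 2)).add
      ((IsTrigPoly.const (V := E d) (-1 / 2)).mul (hsin i))).mono (K' := 1) (r' := R⁻¹)
      (by norm_num) (by simp [hR.le]) using 2 with x
    rw [sinCoord]; push_cast; ring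
  have h3 : ∀ i, IsTrigPoly (fun x : E d => ((bern n (j i) (sinCoord R x i) : ℝ) : ℂ))
      (n.choose (j i)) (n / R) := fun i => by
    have hle : (j i : ℕ) ≤ n := Nat.lt_succ_iff.1 (j i).2
    convert ((IsTrigPoly.const (V := E d) (n.choose (j i) : ℂ)).mul ((h1 i).pow (j i))).mul
      ((h2 i).pow (n - j i)) using 1
    · ext x; simp [bern]
    · simp
    · rw [Nat.cast_sub hle]; ring
  convert IsTrigPoly.prod Finset.univ (fun i _ => h3 i) using 1
  · ext x; simp [trigBern]
  · simp

lemma sum_prod_choose (n : ℕ) :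
    ∑ j : Fin d → Fin (n + 1), ∏ i, (n.choose (j i) : ℝ) = (2 ^ n) ^ d := by
  rw [sum_prod_pi fun _ k => (n.choose k : ℝ)]
  have : ∑ k : Fin (n + 1), (n.choose k : ℝ) = 2 ^ n := by
    rw [← Fin.sum_univ_eq_sum_range (n := n + 1) (fun k => (n.choose k : ℝ)) |>.symm]
    exact_mod_cast Nat.sum_range_choose n
  simp [this]

end bernstein

/-! ### The smoothing inequality for the location measures -/

/-- A smoothing inequality: the Wasserstein distance of two measures on a ball is controlled by
their characteristic functions at low frequencies. -/
lemma W1_le_of_charFun_sub_le {P P' : Measure (E d)} [IsProbabilityMeasure P]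
    [IsProbabilityMeasure P'] {R η δ : ℝ} (hR : 0 < R) (hP : ∀ᵐ x ∂P, ‖x‖ ≤ R)
    (hP' : ∀ᵐ x ∂P', ‖x‖ ≤ R) (hη : 0 < η) (hδ : 0 ≤ δ) {n : ℕ} (hn : n ≠ 0)
    (h : ∀ w : E d, ‖w‖ ≤ d * (n / R) → ‖charFun P w - charFun P' w‖ ≤ δ) :
    W1 P P' ≤ η / 2 + 32 * R ^ 2 * d / (n * η) + 2 * R * ((2 ^ n) ^ d * δ) := by
  set Q : (Fin d → Fin (n + 1)) → E d → ℝ :=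
    fun j x => ∑ i, (sinCoord R x i - (j i : ℕ) / n) ^ 2 with hQ
  have hQ0 : ∀ j x, 0 ≤ Q j x := fun j x => Finset.sum_nonneg fun i _ => sq_nonneg _
  have hsc := continuous_sinCoord (d := d) R
  have hQc : ∀ j, Continuous (Q j) := fun j => by fun_prop
  have hn' : (0 : ℝ) < n := by positivity
  -- The inequality dist ≤ η/2 + dist²/(2η) trades the distance for its square, which splits through
  -- the node j/n into a function of x plus a function of y.
  have key := W1_le_of_partition (ψ := trigBern R n) (F := fun j x => η / 4 + 64 * R ^ 2 / η * Q j x)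
    (κ := η / 4 + 64 * R ^ 2 / η * (d / (4 * n))) hR.le hP hP'
    (continuous_trigBern R n) (fun j => by have := hQc j; fun_prop) (trigBern_nonneg R n)
    (fun j x => by have := hQ0 j x; positivity) (sum_trigBern R n) ?_ ?_
  · refine key.trans ?_
    have hsum : ∑ j, |∫ x, trigBern R n j x ∂P - ∫ x, trigBern R n j x ∂P'| ≤ (2 ^ n) ^ d * δ := by
      rw [← sum_prod_choose (d := d) n, Finset.sum_mul]
      refine Finset.sum_le_sum fun j _ => ?_
      have := (isTrigPoly_trigBern hR n j).norm_integral_sub_le hδ h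
      rwa [integral_complex_ofReal, integral_complex_ofReal, ← Complex.ofReal_sub,
        Complex.norm_real, Real.norm_eq_abs] at this
    have e : 2 * (η / 4 + 64 * R ^ 2 / η * (d / (4 * n))) =
        η / 2 + 32 * R ^ 2 * d / (n * η) := by field_simp; ring
    rw [e]
    gcongr
  · intro j x y hx hy
    have h1 := dist_sq_le_sinCoord hR hx hy
    have h2 : ∑ i, (sinCoord R x i - sinCoord R y i) ^ 2 ≤ 2 * (Q j x + Q j y) := by
      rw [hQ]; simp only
      rw [← Finset.sum_add_distrib, Finset.mul_sum]
      refine Finset.sum_le_sum fun i _ => ?_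
      nlinarith [sq_nonneg (sinCoord R x i - (j i : ℕ) / n + (sinCoord R y i - (j i : ℕ) / n))]
    have h3 : dist x y ^ 2 ≤ 128 * R ^ 2 * (Q j x + Q j y) := by
      calc _ ≤ 64 * R ^ 2 * (2 * (Q j x + Q j y)) := h1.trans (by gcongr)
        _ = _ := by ring
    have h4 : dist x y ≤ η / 2 + dist x y ^ 2 / (2 * η) := by
      rw [div_add_div _ _ two_ne_zero (by positivity), le_div_iff₀ (by positivity)]
      nlinarith [sq_nonneg (dist x y - η)]
    calc dist x y ≤ η / 2 + 128 * R ^ 2 * (Q j x + Q j y) / (2 * η) := h4.trans (by gcongr)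
      _ = _ := by field_simp; ring
  · intro x
    have e : ∀ j, trigBern R n j x * (η / 4 + 64 * R ^ 2 / η * Q j x) =
        trigBern R n j x * (η / 4) + 64 * R ^ 2 / η * (trigBern R n j x * Q j x) := fun j => by ring
    simp_rw [e]
    rw [Finset.sum_add_distrib, ← Finset.sum_mul, sum_trigBern, one_mul, ← Finset.mul_sum]
    gcongr
    exact sum_trigBern_mul_sq R hn x

/-- The characteristic functions of the mixing measures are close at low frequencies if the mixtures
and the scale matrices are close. -/
lemma norm_charFun_sub_charFun_le {lmin lmax : ℝ} {P P' : Measure (E d)}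
    [IsProbabilityMeasure P] [IsProbabilityMeasure P'] {S S' : Matrix (Fin d) (Fin d) ℝ}
    (hS : S ∈ spdBand d lmin lmax) (hS' : S' ∈ spdBand d lmin lmax) (ξ : E d) :
    ‖charFun P ξ - charFun P' ξ‖ ≤
      l1Dist (mixtureDensity (gaussianKern d) (P, S)) (mixtureDensity (gaussianKern d) (P', S')) *
        Real.exp (lmax * ‖ξ‖ ^ 2 / 2) + opNorm (S - S') * ‖ξ‖ ^ 2 / 2 := by
  -- This ordering makes the remaining factor 1 - exp(-x) with x ≥ 0, hence at most x.
  wlog hq : quad S ξ ≤ quad S' ξ generalizing P P' S S'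
  · rw [norm_sub_rev, l1Dist_comm, opNorm_sub_comm]
    exact this hS' hS (le_of_not_ge hq)
  have h := norm_charFun_sub_le (P := P) (P' := P') hS.1 hS'.1 ξ
  set ε := l1Dist (mixtureDensity (gaussianKern d) (P, S)) (mixtureDensity (gaussianKern d) (P', S'))
  set a := charFun P ξ
  set b := charFun P' ξ with hb
  have e : a - b = (a * ((Real.exp (-(quad S ξ / 2)) : ℝ) : ℂ) -
      b * ((Real.exp (-(quad S' ξ / 2)) : ℝ) : ℂ)) * ((Real.exp (quad S ξ / 2) : ℝ) : ℂ) -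
      b * ((1 - Real.exp (-((quad S' ξ - quad S ξ) / 2)) : ℝ) : ℂ) := by
    rw [sub_mul, mul_assoc, mul_assoc, ← Complex.ofReal_mul, ← Complex.ofReal_mul, ← Real.exp_add,
      ← Real.exp_add, neg_add_cancel, Real.exp_zero,
      show -(quad S' ξ / 2) + quad S ξ / 2 = -((quad S' ξ - quad S ξ) / 2) by ring]
    push_cast; ring
  rw [e]
  refine (norm_sub_le _ _).trans (add_le_add ?_ ?_)
  · rw [norm_mul, Complex.norm_real, Real.norm_of_nonneg (Real.exp_pos _).le]
    have := quad_le hS ξ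
    exact mul_le_mul h (Real.exp_le_exp.2 (by linarith)) (Real.exp_pos _).le (l1Dist_nonneg _ _)
  · have hx : 0 ≤ (quad S' ξ - quad S ξ) / 2 := by linarith
    have h1 : Real.exp (-((quad S' ξ - quad S ξ) / 2)) ≤ 1 := Real.exp_le_one_iff.2 (by linarith)
    have h2 := Real.add_one_le_exp (-((quad S' ξ - quad S ξ) / 2))
    have h3 := (abs_le.1 (abs_quad_le_opNorm (S - S') ξ)).1
    rw [quad_sub] at h3
    rw [norm_mul, Complex.norm_real, Real.norm_of_nonneg (by linarith)]
    calc ‖b‖ * (1 - Real.exp (-((quad S' ξ - quad S ξ) / 2))) ≤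
        1 * (1 - Real.exp (-((quad S' ξ - quad S ξ) / 2))) := by
          gcongr
          exact norm_charFun_le_one _
      _ ≤ _ := by linarith


/-! ### Solving the smoothing inequality for the `L¹` distance -/

lemma exp_neg_sq_div_le {R w : ℝ} (hw : 0 < w) (hwR : w ≤ 2 * R) :
    Real.exp (-(64 * R ^ 2 / w ^ 2)) ≤ w / (8 * R) := by
  set u := 8 * R / w with hu
  have hu1 : 1 ≤ u := by rw [hu, le_div_iff₀ hw]; linarith
  have h1 : u ≤ Real.exp (u ^ 2) := by
    have := Real.add_one_le_exp (u ^ 2)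
    nlinarith
  have e : 64 * R ^ 2 / w ^ 2 = u ^ 2 := by rw [hu, div_pow]; ring
  rw [e, Real.exp_neg, show w / (8 * R) = u⁻¹ by rw [hu, inv_div]]
  exact inv_anti₀ (by linarith) h1

/-- The value of `gaussianPsi M` at exp(-x) is the left side, the source of the double exponential.
For t beyond e monotonicity fails, but the value is still at least 1. -/
lemma gaussianPsi_exp_neg_le {M x t : ℝ} (hM : 0 < M) (hx : 0 ≤ x) (ht : Real.exp (-x) ≤ t) :
    Real.exp (-(M * (x * Real.exp x))) ≤ gaussianPsi M t := by
  have h1 : Real.exp (-x) ≤ 1 := Real.exp_le_one_iff.2 (by linarith)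
  have he : (1 : ℝ) ≤ Real.exp 1 := by linarith [Real.add_one_le_exp 1]
  have e : gaussianPsi M (Real.exp (-x)) = Real.exp (-(M * (x * Real.exp x))) := by
    rw [gaussianPsi, if_neg (Real.exp_pos _).ne', one_div, ← Real.exp_neg, neg_neg, Real.log_exp,
      Real.exp_neg x, div_inv_eq_mul]
  have hmono := (strictMonoOn_gaussianPsi hM).monotoneOn
  have hmem : Real.exp (-x) ∈ Icc 0 (Real.exp 1) := ⟨(Real.exp_pos _).le, h1.trans he⟩
  rw [← e]
  rcases le_total t (Real.exp 1) with h | h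
  · exact hmono hmem ⟨(Real.exp_pos _).le.trans ht, h⟩ ht
  · calc _ ≤ gaussianPsi M 1 := hmono hmem ⟨zero_le_one, he⟩ h1
      _ = 1 := by simp [gaussianPsi]
      _ ≤ _ := one_le_gaussianPsi hM (he.trans h)

/-- Solving the smoothing inequality for the `L¹` distance `ε`: here `w` is the Wasserstein distance
of the location measures and `t` the distance of the scale matrices. -/
lemma exists_gaussianPhi_le {R lmax M C₁ : ℝ} (hR : 0 < R) (hmax : 0 < lmax) (hM : 0 < M)
    (hC₁ : 0 < C₁) (d : ℕ) :
    ∃ C > 0, ∃ Ct > 0, ∃ c > 0, ∀ w ε t : ℝ, 0 ≤ w → w ≤ 2 * R → 0 ≤ ε → 0 ≤ t →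
      C₁ * gaussianPsi M t ≤ ε →
      (0 < w → ∀ n : ℕ, n ≠ 0 → w ≤ w / 2 + 32 * R ^ 2 * d / (n * w) +
        2 * R * ((2 ^ n) ^ d * (ε * Real.exp (lmax * (d * (n / R)) ^ 2 / 2) +
          t * (d * (n / R)) ^ 2 / 2))) →
      c * gaussianPhi C Ct w ≤ ε := by
  -- With y = 1/w²: n ≤ c₃ y, where 8R² y ≥ 2 pays for rounding; exp(-c₄ y) bounds the discrepancy
  -- below, c₃ d accounting for 2^(nd) and 64R² for the factor w/(8R); a adds the cost of r² ≤
  -- exp(2r).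
  set c₃ := 128 * R ^ 2 * d + 8 * R ^ 2 with hc₃
  set c₄ := c₃ * d + 64 * R ^ 2 with hc₄
  set a := c₄ + 2 * (c₃ * d / R) with ha
  have hc₃0 : 0 < c₃ := by positivity
  have hc₄0 : 0 < c₄ := by positivity
  have ha0 : 0 < a := by positivity
  refine ⟨M * a + c₄ + lmax * (c₃ * d / R) ^ 2 / (2 * a), by positivity, a, ha0, min C₁ (1 / 2),
    lt_min hC₁ (by norm_num), fun w ε t hw hwR hε ht hψ hsm => ?_⟩
  rcases hw.eq_or_lt with h0 | h0
  · rw [← h0]; simpa [gaussianPhi] using hε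
  rw [gaussianPhi, if_neg h0.ne']
  have hw2 : 0 < w ^ 2 := by positivity
  set y := 1 / w ^ 2 with hy
  have hy0 : 0 < y := by positivity
  set X := Real.exp (a / w ^ 2) with hX
  have hX1 : 1 ≤ X := Real.one_le_exp (by positivity)
  -- This makes the concentration error 32R²d/(nw) at most w/4, leaving w/4 for the characteristic
  -- functions; the +1 keeps n nonzero when d = 0.
  set n := ⌈128 * R ^ 2 * d / w ^ 2⌉₊ + 1 with hn
  have hn1 : 128 * R ^ 2 * d / w ^ 2 ≤ n := by
    rw [hn]; push_cast; linarith [Nat.le_ceil (128 * R ^ 2 * d / w ^ 2)]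
  have hn2 : (n : ℝ) ≤ c₃ * y := by
    have h1 := (Nat.ceil_lt_add_one (by positivity : 0 ≤ 128 * R ^ 2 * d / w ^ 2)).le
    have h2 : 2 ≤ 8 * R ^ 2 / w ^ 2 := by
      rw [le_div_iff₀ hw2]; nlinarith
    have h3 : c₃ * y = 128 * R ^ 2 * d / w ^ 2 + 8 * R ^ 2 / w ^ 2 := by rw [hc₃, hy]; ring
    rw [hn]; push_cast; linarith
  have hn0 : (0 : ℝ) < n := by positivity
  set r := (d : ℝ) * (n / R) with hr
  have hr0 : 0 ≤ r := by positivity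
  have hr1 : r ≤ c₃ * d / R * y := by
    calc r ≤ d * (c₃ * y / R) := by rw [hr]; gcongr
      _ = _ := by ring
  have hδ : Real.exp (-(c₄ * y)) ≤ ε * Real.exp (lmax * r ^ 2 / 2) + t * r ^ 2 / 2 := by
    have h1 := hsm h0 n (by positivity)
    set δ := ε * Real.exp (lmax * r ^ 2 / 2) + t * r ^ 2 / 2 with hδ
    have hδ0 : 0 ≤ δ := by positivity
    have h2 : 32 * R ^ 2 * d / (n * w) ≤ w / 4 := by
      rw [div_le_div_iff₀ (by positivity) (by norm_num)]
      rw [div_le_iff₀ hw2] at hn1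
      linarith
    have h3 : ((2 : ℝ) ^ n) ^ d ≤ Real.exp (n * d) := by
      rw [← pow_mul, ← Nat.cast_mul, ← mul_one (((n * d : ℕ) : ℝ)), Real.exp_nat_mul]
      exact pow_le_pow_left₀ (by norm_num) (by linarith [Real.add_one_le_exp 1]) _
    have h4 : w / (8 * R) ≤ Real.exp (n * d) * δ := by
      rw [div_le_iff₀ (by positivity)]
      have : (2 ^ n) ^ d * δ ≤ Real.exp (n * d) * δ := by gcongr
      nlinarith
    have h5 : Real.exp (-(64 * R ^ 2 * y)) ≤ w / (8 * R) := by
      rw [hy, mul_one_div]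
      exact exp_neg_sq_div_le h0 hwR
    calc Real.exp (-(c₄ * y)) = Real.exp (-(c₃ * y * d)) * Real.exp (-(64 * R ^ 2 * y)) := by
          rw [← Real.exp_add, hc₄]; congr 1; ring
      _ ≤ Real.exp (-(n * d)) * (Real.exp (n * d) * δ) := by
          gcongr
          exact h5.trans h4
      _ = δ := by rw [← mul_assoc, ← Real.exp_add]; simp
  have hexp : ∀ {A B : ℝ}, A ≤ B → Real.exp (-B) ≤ Real.exp (-A) := fun h =>
    Real.exp_le_exp.2 (neg_le_neg h)
  have hK : 0 ≤ lmax * (c₃ * d / R) ^ 2 / (2 * a) := by positivity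
  rw [div_eq_mul_one_div _ (w ^ 2), ← hy]
  clear_value c₃ c₄ a r y X
  -- Either the scale term carries half of the lower bound, and the scale inequality applies with t
  -- ≥ exp(-a y), or the term with ε does.
  rcases le_total (Real.exp (-(c₄ * y))) (t * r ^ 2) with hA | hA
  · have h1 : r ^ 2 ≤ Real.exp (2 * (c₃ * d / R * y)) := by
      calc r ^ 2 ≤ Real.exp r ^ 2 := by
            gcongr; linarith [Real.add_one_le_exp r]
        _ = Real.exp (2 * r) := by rw [← Real.exp_nat_mul]; norm_num
        _ ≤ _ := by gcongr
    have h2 : Real.exp (-(a * y)) ≤ t := by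
      have h3 : Real.exp (-(c₄ * y)) ≤ t * Real.exp (2 * (c₃ * d / R * y)) :=
        hA.trans (by gcongr)
      calc Real.exp (-(a * y)) = Real.exp (-(c₄ * y)) * Real.exp (-(2 * (c₃ * d / R * y))) := by
            rw [← Real.exp_add, ha]; congr 1; ring
        _ ≤ t * Real.exp (2 * (c₃ * d / R * y)) * Real.exp (-(2 * (c₃ * d / R * y))) := by gcongr
        _ = t := by rw [mul_assoc, ← Real.exp_add]; simp
    have h3 := gaussianPsi_exp_neg_le hM (by positivity) h2
    have e : Real.exp (a * y) = X := by rw [hX, hy, mul_one_div]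
    rw [e] at h3
    refine le_trans ?_ hψ
    refine mul_le_mul (min_le_left _ _) (le_trans (hexp ?_) h3) (Real.exp_pos _).le hC₁.le
    calc M * (a * y * X) = M * a * (X * y) := by ring
      _ ≤ (M * a + c₄ + lmax * (c₃ * d / R) ^ 2 / (2 * a)) * (X * y) := by gcongr; linarith
      _ = _ := by ring
  · have hB : 1 / 2 * Real.exp (-(c₄ * y)) ≤ ε * Real.exp (lmax * r ^ 2 / 2) := by linarith
    have h1 : 1 / 2 * Real.exp (-(c₄ * y + lmax * r ^ 2 / 2)) ≤ ε := by
      rw [neg_add, Real.exp_add, ← mul_assoc]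
      calc _ ≤ ε * Real.exp (lmax * r ^ 2 / 2) * Real.exp (-(lmax * r ^ 2 / 2)) := by gcongr
        _ = ε := by rw [mul_assoc, ← Real.exp_add]; simp
    refine le_trans ?_ h1
    refine mul_le_mul (min_le_right _ _) (hexp ?_) (Real.exp_pos _).le (by norm_num)
    -- Here the exponent is only of order y + y²; one factor y is traded for X/a to fit the common
    -- form X y.
    have h2 : a * y ≤ X := by
      have := Real.add_one_le_exp (a / w ^ 2)
      rw [hX, hy, mul_one_div]; linarith
    have h3 : lmax * r ^ 2 / 2 ≤ lmax * (c₃ * d / R) ^ 2 / (2 * a) * (X * y) := by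
      calc lmax * r ^ 2 / 2 ≤ lmax * (c₃ * d / R * y) ^ 2 / 2 := by gcongr
        _ = lmax * (c₃ * d / R) ^ 2 / (2 * a) * (a * y * y) := by field_simp
        _ ≤ _ := by gcongr
    have h4 : c₄ * y ≤ c₄ * (X * y) := by
      gcongr; nlinarith
    have h5 : 0 ≤ M * a * (X * y) := by positivity
    calc c₄ * y + lmax * r ^ 2 / 2 ≤
        (M * a + c₄ + lmax * (c₃ * d / R) ^ 2 / (2 * a)) * (X * y) := by linarith
      _ = _ := by ring

end LocScale

/-! ### Assembly of the theorem -/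

theorem theorem4p1 (R lmin lmax : ℝ) (hR : 0 < R) (hmin : 0 < lmin) (hlt : lmin < lmax) :
    (∀ d : ℕ, LocScale.IsSuperSmooth (LocScale.gaussianKern d) lmin lmax 2) ∧
    ∃ M > 0, StrictMonoOn (LocScale.gaussianPsi M) (Set.Icc 0 (Real.exp 1)) ∧
      ∀ d : ℕ,
        LocScale.ScaleLowerBound (LocScale.gaussianKern d) R lmin lmax
          (LocScale.gaussianPsi M) ∧
        (∃ Ψ : ℝ → ℝ, Set.EqOn Ψ (LocScale.gaussianPsi M) (Set.Icc 0 (Real.exp 1)) ∧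
          LocScale.Assumption1 (LocScale.gaussianKern d) R lmin lmax Ψ) ∧
        LocScale.Assumption2 (LocScale.gaussianKern d) lmin lmax 2 (fun t => t) ∧
        ∃ C > 0, ∃ C' > 0, ∃ Ct > 0,
          ∀ X : Set (LocScale.E d), MeasurableSet X → X ⊆ Metric.closedBall 0 R →
            ∀ G ∈ LocScale.mixingClass d X lmin lmax,
            ∀ G' ∈ LocScale.mixingClass d X lmin lmax,
              C' * (LocScale.gaussianPhi C Ct (LocScale.W1 G.1 G'.1) +
                  LocScale.gaussianPsi M (LocScale.opNorm (G.2 - G'.2))) ≤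
                LocScale.l1Dist (LocScale.mixtureDensity (LocScale.gaussianKern d) G)
                  (LocScale.mixtureDensity (LocScale.gaussianKern d) G') := by
  have hmax : 0 < lmax := hmin.trans hlt
  refine ⟨fun d => LocScale.isSuperSmooth_gaussianKern hmin hlt, ?_⟩
  obtain ⟨M, hM, C₁, hC₁, hscale⟩ := LocScale.exists_gaussianPsi_le_l1Dist hR hmin hlt
  refine ⟨M, hM, LocScale.strictMonoOn_gaussianPsi hM, fun d =>
    ⟨⟨C₁, hC₁, fun X _ hX => hscale d X hX⟩, ⟨LocScale.gaussianPsiExt M,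
      LocScale.eqOn_gaussianPsiExt M, LocScale.strictMonoOn_gaussianPsiExt hM,
      LocScale.mapsTo_gaussianPsiExt M, ?_⟩, LocScale.assumption2_gaussianKern, ?_⟩⟩
  · obtain ⟨c, hc, hcle⟩ := LocScale.exists_gaussianPsiExt_le hM hmax
    refine ⟨C₁ * c, by positivity, fun X _ hX G hG G' hG' => ?_⟩
    refine le_trans ?_ (hscale d X hX G hG G' hG')
    rw [mul_assoc]
    exact mul_le_mul_of_nonneg_left
      (hcle _ (LocScale.opNorm_sub_le hmin hlt hG.2.2 hG'.2.2)) hC₁.le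
  · obtain ⟨C, hC, Ct, hCt, c, hc, hΦ⟩ := LocScale.exists_gaussianPhi_le hR hmax hM hC₁ d
    -- The location and scale bounds each hold separately; averaging them gives the sum with the
    -- factor 1/2.
    refine ⟨C, hC, min c C₁ / 2, by positivity, Ct, hCt, fun X _ hX G hG G' hG' => ?_⟩
    have h1 := hscale d X hX G hG G' hG'
    have hP := LocScale.ae_norm_le_of_mem_mixingClass hX hG
    have hP' := LocScale.ae_norm_le_of_mem_mixingClass hX hG'
    obtain ⟨P, S⟩ := G
    obtain ⟨P', S'⟩ := G'
    have : MeasureTheory.IsProbabilityMeasure P := hG.1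
    have : MeasureTheory.IsProbabilityMeasure P' := hG'.1
    simp only at hP hP' h1 ⊢
    have hε := LocScale.l1Dist_nonneg
      (LocScale.mixtureDensity (LocScale.gaussianKern d) (P, S))
      (LocScale.mixtureDensity (LocScale.gaussianKern d) (P', S'))
    have ht := LocScale.opNorm_nonneg (S - S')
    -- The smoothing parameter η is taken to be the Wasserstein distance itself.
    have h2 := hΦ (LocScale.W1 P P') _ _ (LocScale.W1_nonneg P P')
      (LocScale.W1_le_two_mul hR.le hP hP') hε ht h1 fun hw n hn =>
        LocScale.W1_le_of_charFun_sub_le hR hP hP' hw (by positivity) hn fun ξ hξ =>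
          (LocScale.norm_charFun_sub_charFun_le hG.2.2 hG'.2.2 ξ).trans (by gcongr)
    have hψ := LocScale.gaussianPsi_nonneg M (LocScale.opNorm (S - S'))
    have hφ : 0 ≤ LocScale.gaussianPhi C Ct (LocScale.W1 P P') := by
      unfold LocScale.gaussianPhi; split_ifs <;> positivity
    have h3 := mul_le_mul_of_nonneg_right (min_le_left c C₁) hφ
    have h4 := mul_le_mul_of_nonneg_right (min_le_right c C₁) hψ
    linarith
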